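/- Let $k$ be a field, $A$ a unital associative $k$-algebra (not necessarily commutative), and $M$ an $A$-bimodule on which $k$ acts centrally, equipped with an associative $A$-bimodule map $M\otimes_A M\to M$, $m\otimes m'\mapsto m.m'$. Let $\Lambda=A\oplus M$ be the corresponding split algebra, with product $$(a+m)(a'+m')=aa'+am'+ma'+m.m',$$ and let $X$ be a $\Lambda$-bimodule on which $k$ acts centrally. Let $d:\mathrm{Hom}_k(\Lambda^{\otimes n},X)\to \mathrm{Hom}_k(\Lambda^{\otimes (n+1)},X)$, $n\ge 0$, be the Hochschild coboundary $$df(x_1\otimes\dots\otimes x_{n+1})=x_1f(x_2\otimes\dots\otimes x_{n+1})+\sum_{i=1}^n(-1)^i f(x_1\otimes\dots\otimes x_ix_{i+1}\otimes\dots\otimes x_{n+1})+(-1)^{n+1}f(x_1\otimes\dots\otimes x_n)x_{n+1}.$$ For $p,q\ge 0$ let $M^{p,q}\subseteq\Lambda^{\otimes(p+q)}$ be the subspace spanned by the tensors of elements of $A$ and $M$ with exactly $p$ entries in $M$ and $q$ entries in $A$, so that $\Lambda^{\otimes n}=\bigoplus_{p+q=n}M^{p,q}$, and regard $\mathrm{Hom}_k(M^{p,q},X)$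 as the space of cochains that vanish on the other summands. Then $d$ maps $\mathrm{Hom}_k(M^{p,q},X)$ into $\mathrm{Hom}_k(M^{p+1,q},X)\oplus\mathrm{Hom}_k(M^{p,q+1},X)$, which makes the Hochschild complex into a double complex; its $p$-th column $\mathcal C^p(X)$ is the complex with term $\mathrm{Hom}_k(M^{p,q},X)$ in degree $q$ and with differential $d_v:\mathrm{Hom}_k(M^{p,q},X)\to\mathrm{Hom}_k(M^{p,q+1},X)$ the corresponding component of $d$. **Theorem.** Assume that $M$ is projective as a left $A$-module or projective as a right $A$-module. Then for all $p,q\ge 0$ there is an isomorphism of $k$-vector spaces $$H^q(\mathcal C^p(X))\;\cong\;\mathrm{Ext}^q_{A-A}(M^{\otimes_A p},X),$$ where $M^{\otimes_A 0}=A$, $\mathrm{Ext}_{A-A}$ is taken in the category of $A$-bimodules, that is, of left $A\otimes_k A^{op}$-modules, and $X$ is an $A$-bimodule by restriction of scalars along $A\subseteq\Lambda$. -/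

import Mathlib

open CategoryTheory MulOpposite
open scoped TensorProduct

set_option linter.unusedSectionVars false

universe v u

noncomputable section

/-! ### Multiplicative bimodules and split algebras -/

/-- The compatibility laws making the product of `M` an (associative) `A`-bimodule map
`M ⊗_A M → M`; the right action `m · a` is written `op a • m`. Associativity and biadditivity of
the product are part of `NonUnitalRing M`. -/
class MultiplicativeBimodule (A M : Type u) [Ring A] [NonUnitalRing M] [Module A M]
    [Module Aᵐᵒᵖ M] : Prop where
  smul_mul : ∀ (a : A) (m m' : M), (a • m) * m' = a • (m * m')
  mul_op_smul : ∀ (a : A) (m m' : M), m * (op a • m') = op a • (m * m')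
  op_smul_mul : ∀ (a : A) (m m' : M), (op a • m) * m' = m * (a • m')

/-- The underlying space `A ⊕ M` of the split algebra. -/
def SplitAlgebra (A M : Type u) : Type u := A × M

namespace SplitAlgebra

variable {k : Type v} {A M : Type u}

section Ring

variable [Ring A] [NonUnitalRing M]

instance : AddCommGroup (SplitAlgebra A M) := inferInstanceAs (AddCommGroup (A × M))

@[simp] theorem fst_add (x y : SplitAlgebra A M) : (x + y).1 = x.1 + y.1 := rfl
@[simp] theorem snd_add (x y : SplitAlgebra A M) : (x + y).2 = x.2 + y.2 := rfl
@[simp] theorem fst_zero : (0 : SplitAlgebra A M).1 = 0 := rfl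
@[simp] theorem snd_zero : (0 : SplitAlgebra A M).2 = 0 := rfl

@[ext] theorem ext {x y : SplitAlgebra A M} (h₁ : x.1 = y.1) (h₂ : x.2 = y.2) : x = y :=
  Prod.ext h₁ h₂

variable [Module A M] [Module Aᵐᵒᵖ M]

/-- `(a + m)(a' + m') = a a' + (a m' + m a' + m m')`. -/
instance : Mul (SplitAlgebra A M) :=
  ⟨fun x y => (x.1 * y.1, x.1 • y.2 + op y.1 • x.2 + x.2 * y.2)⟩

instance : One (SplitAlgebra A M) := ⟨((1 : A), (0 : M))⟩

@[simp] theorem fst_mul (x y : SplitAlgebra A M) : (x * y).1 = x.1 * y.1 := rfl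
@[simp] theorem snd_mul (x y : SplitAlgebra A M) :
    (x * y).2 = x.1 • y.2 + op y.1 • x.2 + x.2 * y.2 := rfl
@[simp] theorem fst_one : (1 : SplitAlgebra A M).1 = 1 := rfl
@[simp] theorem snd_one : (1 : SplitAlgebra A M).2 = 0 := rfl
variable [SMulCommClass A Aᵐᵒᵖ M] [MultiplicativeBimodule A M]

instance : Ring (SplitAlgebra A M) where
  __ := (inferInstance : AddCommGroup (SplitAlgebra A M))
  mul := (· * ·)
  one := 1
  left_distrib x y z := by
    ext <;> simp [mul_add, add_smul, smul_add]; abel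
  right_distrib x y z := by
    ext <;> simp [add_mul, add_smul, smul_add]; abel
  zero_mul x := by ext <;> simp
  mul_zero x := by ext <;> simp
  one_mul x := by ext <;> simp
  mul_one x := by ext <;> simp
  mul_assoc x y z := by
    ext
    · simp [mul_assoc]
    · simp [mul_add, add_mul, smul_add, mul_smul, mul_assoc, MultiplicativeBimodule.smul_mul,
        MultiplicativeBimodule.mul_op_smul, MultiplicativeBimodule.op_smul_mul]
      rw [smul_comm x.1 (op z.1) y.2]
      abel

variable [Field k] [Algebra k A] [Module k M] [IsScalarTower k A M] [IsScalarTower k Aᵐᵒᵖ M]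

instance : Module k (SplitAlgebra A M) := inferInstanceAs (Module k (A × M))

@[simp] theorem fst_smul (c : k) (x : SplitAlgebra A M) : (c • x).1 = c • x.1 := rfl
@[simp] theorem snd_smul (c : k) (x : SplitAlgebra A M) : (c • x).2 = c • x.2 := rfl

instance : Algebra k (SplitAlgebra A M) := by
  have h₁ : ∀ (c : k) (m : M), c • m = (c • (1 : A)) • m := fun c m => by simp
  have h₂ : ∀ (c : k) (m : M), c • m = op (c • (1 : A)) • m := fun c m => by simp
  have h₃ : ∀ (c : k) (m m' : M), (c • m) * m' = c • (m * m') := fun c m m' => by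
    rw [h₁, MultiplicativeBimodule.smul_mul, ← h₁]
  have h₄ : ∀ (c : k) (m m' : M), m * (c • m') = c • (m * m') := fun c m m' => by
    rw [h₂, MultiplicativeBimodule.mul_op_smul, ← h₂]
  have h₅ : ∀ (c : k) (a : A) (m : M), a • (c • m) = c • (a • m) := fun c a m => by
    rw [h₁, ← mul_smul, mul_smul_comm, mul_one, smul_assoc]
  have h₆ : ∀ (c : k) (a : A) (m : M), op a • (c • m) = c • (op a • m) := fun c a m => by
    rw [h₂, ← mul_smul, ← op_mul, smul_mul_assoc, one_mul, op_smul, smul_assoc]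
  refine Algebra.ofModule (fun c x y => ?_) (fun c x y => ?_)
  · ext
    · simp
    · simp [h₃, h₆, smul_add]
  · ext
    · simp
    · simp [h₄, h₅, smul_add]

variable (k A M)

/-- The inclusion of `A` in `A ⊕ M`, a homomorphism of `k`-algebras. -/
def inl : A →ₐ[k] SplitAlgebra A M :=
  AlgHom.ofLinearMap (LinearMap.inl k A M : A →ₗ[k] A × M) rfl
    (fun a b => by
      ext
      · rfl
      · change (0 : M) = a • (0 : M) + op b • (0 : M) + 0 * 0
        simp)

/-- The projection of `A ⊕ M` onto `A`, as a linear endomorphism. -/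
def projA : SplitAlgebra A M →ₗ[k] SplitAlgebra A M :=
  (LinearMap.inl k A M).comp (LinearMap.fst k A M)

/-- The projection of `A ⊕ M` onto `M`, as a linear endomorphism. -/
def projM : SplitAlgebra A M →ₗ[k] SplitAlgebra A M :=
  (LinearMap.inr k A M).comp (LinearMap.snd k A M)

end Ring

end SplitAlgebra

/-! ### The Hochschild cochain complex -/

namespace Hochschild

open Finset

section Cochains

variable (k : Type v) [Field k] (B : Type u) [Ring B] [Algebra k B]
variable (X : Type u) [AddCommGroup X] [Module k X] [Module B X] [Module Bᵐᵒᵖ X]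
  [SMulCommClass B Bᵐᵒᵖ X] [IsScalarTower k B X] [IsScalarTower k Bᵐᵒᵖ X]

/-- Hochschild `n`-cochains: `Hom_k(B^{⊗ n}, X)`, as `k`-multilinear maps in `n` variables. -/
abbrev Cochain (n : ℕ) : Type u := MultilinearMap k (fun _ : Fin n => B) X

end Cochains

section Differential

variable {k : Type v} [Field k] {B : Type u} [Ring B] [Algebra k B]
variable {X : Type u} [AddCommGroup X] [Module k X] [Module B X] [Module Bᵐᵒᵖ X]
  [SMulCommClass B Bᵐᵒᵖ X] [IsScalarTower k B X] [IsScalarTower k Bᵐᵒᵖ X]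

/-- Changing one entry `i` of a word changes the contracted word in one entry, linearly. -/
theorem contractNth_update {n : ℕ} (j : Fin n) (i : Fin (n + 1)) (x : Fin (n + 1) → B) :
    ∃ L : B →ₗ[k] B, ∀ y : B, Fin.contractNth j.castSucc (· * ·) (Function.update x i y) =
      Function.update (Fin.contractNth j.castSucc (· * ·) x) (j.predAbove i) (L y) := by
  refine ⟨if i = j.castSucc then LinearMap.mulRight k (x j.succ)
    else if i = j.succ then LinearMap.mulLeft k (x j.castSucc) else LinearMap.id, fun y => ?_⟩
  funext l
  rcases Fin.lt_or_le j.castSucc i with h | h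
  · rw [Fin.predAbove_of_castSucc_lt _ _ h]
    obtain ⟨i, rfl⟩ : ∃ i', i = Fin.succ i' := ⟨i.pred (Fin.ne_zero_of_lt h), by simp⟩
    simp only [Fin.contractNth, Function.update_apply, Fin.ext_iff, Fin.val_castSucc,
      Fin.val_succ, Fin.pred_succ, Fin.lt_def] at h ⊢
    by_cases h₁ : (l : ℕ) < j
    · simp only [h₁, if_true]; split_ifs <;> first | rfl | omega
    · by_cases h₂ : (l : ℕ) = j
      · obtain rfl : l = j := Fin.ext h₂
        by_cases h₃ : (i : ℕ) = l
        · obtain rfl : i = l := Fin.ext h₃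
          simp
        · rw [if_neg (by omega), if_pos rfl, if_neg (by omega), if_neg (by omega),
            if_neg (by omega), if_neg (by omega), if_pos rfl]
      · simp only [h₁, h₂, if_false]; split_ifs <;> first | rfl | omega
  · rw [Fin.predAbove_of_le_castSucc _ _ h]
    obtain ⟨i, rfl⟩ : ∃ i', i = Fin.castSucc i' :=
      ⟨i.castPred (Fin.ne_last_of_lt (lt_of_le_of_lt h (Fin.castSucc_lt_last j))), by simp⟩
    simp only [Fin.contractNth, Function.update_apply, Fin.ext_iff, Fin.val_castSucc,
      Fin.val_succ, Fin.castPred_castSucc, Fin.le_def] at h ⊢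
    by_cases h₁ : (l : ℕ) < j
    · simp only [h₁, if_true]; split_ifs <;> first | rfl | omega
    · by_cases h₂ : (l : ℕ) = j
      · obtain rfl : l = j := Fin.ext h₂
        by_cases h₃ : (i : ℕ) = l
        · obtain rfl : i = l := Fin.ext h₃
          simp
        · rw [if_neg (by omega), if_pos rfl, if_neg (by omega), if_neg (by omega),
            if_neg (by omega), if_neg (by omega), if_pos rfl]
      · simp only [h₁, h₂, if_false]; split_ifs <;> first | rfl | omega

/-- `x ↦ x₁ f(x₂, …, x_{n+1})`. -/
def leftTerm {n : ℕ} (f : Cochain k B X n) : Cochain k B X (n + 1) where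
  toFun x := x 0 • f (Fin.tail x)
  map_update_add' {inst} x i a b := by
    obtain rfl := Subsingleton.elim inst (instDecidableEqFin (n + 1))
    refine Fin.cases ?_ (fun i => ?_) i a b
    · intro a b; simp [Fin.tail_update_zero, add_smul]
    · intro a b; simp [Fin.tail_update_succ, smul_add, Function.update_of_ne (Fin.succ_ne_zero i).symm]
  map_update_smul' {inst} x i c a := by
    obtain rfl := Subsingleton.elim inst (instDecidableEqFin (n + 1))
    refine Fin.cases ?_ (fun i => ?_) i a
    · intro a; simp [Fin.tail_update_zero]
    · intro a; simp [Fin.tail_update_succ, smul_comm c, Function.update_of_ne (Fin.succ_ne_zero i).symm]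

/-- `x ↦ f(x₁, …, x_n) x_{n+1}`. -/
def rightTerm {n : ℕ} (f : Cochain k B X n) : Cochain k B X (n + 1) where
  toFun x := op (x (Fin.last n)) • f (Fin.init x)
  map_update_add' {inst} x i a b := by
    obtain rfl := Subsingleton.elim inst (instDecidableEqFin (n + 1))
    refine Fin.lastCases ?_ (fun i => ?_) i a b
    · intro a b; simp [Fin.init_update_last, add_smul]
    · intro a b; simp [Fin.init_update_castSucc, smul_add, Function.update_of_ne (Fin.castSucc_lt_last i).ne']
  map_update_smul' {inst} x i c a := by
    obtain rfl := Subsingleton.elim inst (instDecidableEqFin (n + 1))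
    refine Fin.lastCases ?_ (fun i => ?_) i a
    · intro a; simp [Fin.init_update_last]
    · intro a; simp [Fin.init_update_castSucc, smul_comm c, Function.update_of_ne (Fin.castSucc_lt_last i).ne']

/-- `x ↦ f(x₁, …, x_j x_{j+1}, …, x_{n+1})` (here `j` counts from `0`). -/
def middleTerm {n : ℕ} (j : Fin n) (f : Cochain k B X n) : Cochain k B X (n + 1) where
  toFun x := f (Fin.contractNth j.castSucc (· * ·) x)
  map_update_add' {inst} x i a b := by
    obtain rfl := Subsingleton.elim inst (instDecidableEqFin (n + 1))
    obtain ⟨L, hL⟩ := contractNth_update (k := k) j i x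
    simp only [hL, map_add, MultilinearMap.map_update_add]
  map_update_smul' {inst} x i c a := by
    obtain rfl := Subsingleton.elim inst (instDecidableEqFin (n + 1))
    obtain ⟨L, hL⟩ := contractNth_update (k := k) j i x
    simp only [hL, map_smul, MultilinearMap.map_update_smul]

/-- The Hochschild coboundary
`(df)(x₁, …, x_{n+1}) = x₁ f(x₂, …) + ∑ᵢ (-1)ⁱ f(…, xᵢ xᵢ₊₁, …) + (-1)ⁿ⁺¹ f(x₁, …, x_n) x_{n+1}`. -/
def d (n : ℕ) : Cochain k B X n →ₗ[k] Cochain k B X (n + 1) where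
  toFun f := leftTerm f + ∑ j : Fin n, (-1 : k) ^ ((j : ℕ) + 1) • middleTerm j f +
    (-1 : k) ^ (n + 1) • rightTerm f
  map_add' f g := by
    ext x
    simp [leftTerm, rightTerm, middleTerm, Finset.sum_add_distrib]
    abel
  map_smul' c f := by
    ext x
    simp [leftTerm, rightTerm, middleTerm, Finset.smul_sum, smul_add, smul_comm c]

theorem d_apply {n : ℕ} (f : Cochain k B X n) (x : Fin (n + 1) → B) :
    d n f x = x 0 • f (Fin.tail x) +
      ∑ j : Fin n, (-1 : k) ^ ((j : ℕ) + 1) • f (Fin.contractNth j.castSucc (· * ·) x) +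
      (-1 : k) ^ (n + 1) • op (x (Fin.last n)) • f (Fin.init x) := by
  simp [d, leftTerm, rightTerm, middleTerm]

/-- The cochain `f` surrounded by two coefficients:
`(b₀, x₁, …, x_n, b₁) ↦ b₀ f(x₁, …, x_n) b₁`. -/
def surround {n : ℕ} (f : Cochain k B X n) (y : Fin (n + 2) → B) : X :=
  op (y (Fin.last (n + 1))) • y 0 • f (fun i => y i.succ.castSucc)

theorem surround_d {n : ℕ} (f : Cochain k B X n) (y : Fin (n + 3) → B) :
    surround (d n f) y =
      ∑ i : Fin (n + 2), (-1 : k) ^ (i : ℕ) •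
        surround f (Fin.contractNth i.castSucc (· * ·) y) := by
  rw [Fin.sum_univ_succ, Fin.sum_univ_castSucc, surround, d_apply]
  simp only [smul_add, Finset.smul_sum]
  rw [← add_assoc]
  congr 1
  · congr 1
    · simp only [surround, Fin.val_zero, pow_zero, one_smul]
      rw [Fin.contractNth_apply_of_gt _ _ _ (Fin.last (n + 1)) (by simp),
        Fin.contractNth_apply_of_eq _ _ _ 0 (by simp), mul_smul]
      congr 4
    · refine Finset.sum_congr rfl fun j _ => ?_
      simp only [surround, Fin.val_castSucc, Fin.val_succ]
      rw [Fin.contractNth_apply_of_gt _ _ _ (Fin.last (n + 1)) (by simp),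
        Fin.contractNth_apply_of_lt _ _ _ 0 (by simp), smul_comm (y 0) ((-1 : k) ^ _),
        smul_comm (op _) ((-1 : k) ^ _)]
      congr 4
      funext i
      simp [Fin.contractNth]
  · simp only [surround, Fin.val_succ, Fin.val_last]
    rw [Fin.contractNth_apply_of_eq _ _ _ (Fin.last (n + 1)) (by simp),
      Fin.contractNth_apply_of_lt _ _ _ 0 (by simp)]
    rw [smul_comm (y 0), smul_comm (op _) ((-1 : k) ^ (n + 1)), op_mul, mul_smul,
      smul_comm (y 0) (op _)]
    congr 5
    funext i
    rw [Fin.contractNth_apply_of_lt _ _ _ _ (by simp)]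
    rfl

theorem contractNth_contractNth {n : ℕ} (i : Fin (n + 1)) (j : Fin n) (h : (i : ℕ) ≤ j)
    (y : Fin (n + 2) → B) :
    Fin.contractNth j.castSucc (· * ·) (Fin.contractNth i.castSucc (· * ·) y) =
      Fin.contractNth (Fin.castLT i (lt_of_le_of_lt h j.2)).castSucc (· * ·)
        (Fin.contractNth j.succ.castSucc (· * ·) y) := by
  funext l
  simp only [Fin.contractNth, Fin.val_castSucc, Fin.val_succ, Fin.val_castLT, Fin.succ_castSucc]
  split_ifs <;> first | rfl | omega | exact mul_assoc _ _ _

theorem surround_d_d {n : ℕ} (f : Cochain k B X n) (y : Fin (n + 4) → B) :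
    surround (d (n + 1) (d n f)) y = 0 := by
  rw [surround_d]
  simp only [surround_d, Finset.smul_sum, smul_smul]
  rw [← Finset.sum_product', Finset.univ_product_univ]
  let P := Fin (n + 3) × Fin (n + 2)
  let S : Finset P := {ij : P | (ij.1 : ℕ) ≤ (ij.2 : ℕ)}
  rw [← Finset.sum_add_sum_compl S, ← eq_neg_iff_add_eq_zero, ← Finset.sum_neg_distrib]
  let φ : ∀ ij : P, ij ∈ S → P := fun ij hij =>
    (ij.2.succ, Fin.castLT ij.1 (lt_of_le_of_lt (Finset.mem_filter.mp hij).right ij.2.is_lt))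
  apply Finset.sum_bij φ
  · intro ij hij
    simp_rw [S, φ, Finset.compl_filter, Finset.mem_filter_univ, Fin.val_succ,
      Fin.val_castLT] at hij ⊢
    lia
  · rintro ⟨i, j⟩ hij ⟨i', j'⟩ hij' h
    have h₁ := congrArg (fun z : P => (z.1 : ℕ)) h
    have h₂ := congrArg (fun z : P => (z.2 : ℕ)) h
    simp only [φ, Fin.val_succ, Fin.val_castLT] at h₁ h₂
    exact Prod.ext (Fin.ext h₂) (Fin.ext (by simpa using h₁))
  · rintro ⟨i', j'⟩ hij'
    simp_rw [S, Finset.compl_filter, Finset.mem_filter_univ, not_le] at hij'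
    refine ⟨(j'.castSucc, i'.pred <| ?_), ?_, ?_⟩
    · rintro rfl
      simp only [Fin.val_zero, not_lt_zero] at hij'
    · simpa [S] using! Nat.le_sub_one_of_lt hij'
    · simp only [φ, Fin.castLT_castSucc, Fin.succ_pred]
  · rintro ⟨i, j⟩ hij
    have hij' : (i : ℕ) ≤ j := by simpa [S] using! hij
    rw [contractNth_contractNth i j hij', ← neg_smul]
    congr 1
    simp only [φ, Fin.val_succ, Fin.val_castLT, pow_succ]
    ring

theorem d_d {n : ℕ} (f : Cochain k B X n) : d (n + 1) (d n f) = 0 := by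
  ext x
  have h := surround_d_d f (Fin.cons 1 (Fin.snoc x 1))
  have h₁ : (fun i : Fin (n + 2) => (Fin.cons 1 (Fin.snoc x 1) : Fin (n + 4) → B)
      i.succ.castSucc) = x := by
    funext i
    rw [← Fin.succ_castSucc, Fin.cons_succ, Fin.snoc_castSucc]
  rw [surround, h₁, ← Fin.succ_last, Fin.cons_succ, Fin.snoc_last, Fin.cons_zero, one_smul,
    op_one, one_smul] at h
  exact h

end Differential

end Hochschild

/-! ### The columns of the double complex -/

namespace SplitAlgebra

open Finset Hochschild

section Column

variable (k : Type v) [Field k] (A M : Type u) [Ring A] [Algebra k A] [NonUnitalRing M]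
  [Module k M] [Module A M] [Module Aᵐᵒᵖ M] [SMulCommClass A Aᵐᵒᵖ M] [IsScalarTower k A M]
  [IsScalarTower k Aᵐᵒᵖ M] [MultiplicativeBimodule A M]
variable (X : Type u) [AddCommGroup X] [Module k X] [Module (SplitAlgebra A M) X]
  [Module (SplitAlgebra A M)ᵐᵒᵖ X] [SMulCommClass (SplitAlgebra A M) (SplitAlgebra A M)ᵐᵒᵖ X]
  [IsScalarTower k (SplitAlgebra A M) X] [IsScalarTower k (SplitAlgebra A M)ᵐᵒᵖ X]

variable {A M} in
/-- The entries of the word `x` at the places in `S` belong to `M`, the other ones to `A`. -/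
def HasType {n : ℕ} (S : Finset (Fin n)) (x : Fin n → SplitAlgebra A M) : Prop :=
  (∀ i ∈ S, (x i).1 = 0) ∧ (∀ i ∉ S, (x i).2 = 0)

/-- `Hom_k(M^{p,q}, X)` with `p + q = n`: the Hochschild `n`-cochains of `A ⊕ M` vanishing on all
tensors of elements of `A` and `M` that do not have exactly `p` entries in `M`. -/
def spot (p n : ℕ) : Submodule k (Cochain k (SplitAlgebra A M) X n) where
  carrier := {f | ∀ (S : Finset (Fin n)) (x : Fin n → SplitAlgebra A M),
    S.card ≠ p → HasType S x → f x = 0}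
  add_mem' hf hg S x hS hx := by simp [hf S x hS hx, hg S x hS hx]
  zero_mem' S x _ _ := by simp
  smul_mem' c f hf S x hS hx := by simp [hf S x hS hx]

variable {k A M} in
/-- The entries of `x` at the places in `S` are projected to `M`, the other ones to `A`. -/
def proj {n : ℕ} (S : Finset (Fin n)) (i : Fin n) : SplitAlgebra A M →ₗ[k] SplitAlgebra A M :=
  if i ∈ S then projM k A M else projA k A M

variable {k A M X} in
/-- The component of an `n`-cochain in `Hom_k(M^{p,n-p}, X)`: restriction to `M^{p,n-p}`, extended
by zero on the other direct summands of `(A ⊕ M)^{⊗ n}`. -/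
def component (p n : ℕ) :
    Cochain k (SplitAlgebra A M) X n →ₗ[k] Cochain k (SplitAlgebra A M) X n :=
  ∑ S ∈ powersetCard p (univ : Finset (Fin n)), MultilinearMap.compLinearMapₗ (proj S)

variable {k A M X}

theorem component_apply (p n : ℕ) (f : Cochain k (SplitAlgebra A M) X n)
    (x : Fin n → SplitAlgebra A M) :
    component p n f x =
      ∑ S ∈ powersetCard p (univ : Finset (Fin n)), f (fun i => proj (k := k) S i (x i)) := by
  simp [component, LinearMap.sum_apply]

theorem hasType_proj {n : ℕ} (S : Finset (Fin n)) (x : Fin n → SplitAlgebra A M) :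
    HasType S (fun i => proj (k := k) S i (x i)) := by
  refine ⟨fun i hi => ?_, fun i hi => ?_⟩ <;> simp only [proj, hi, if_true, if_false] <;> rfl

theorem proj_eq_zero {n : ℕ} {S T : Finset (Fin n)} {x : Fin n → SplitAlgebra A M}
    (hx : HasType S x) {i : Fin n} (h : ¬(i ∈ S ↔ i ∈ T)) : proj (k := k) T i (x i) = 0 := by
  by_cases hi : i ∈ S
  · have hT : i ∉ T := by tauto
    simp only [proj, hT, if_false]
    exact SplitAlgebra.ext (hx.1 i hi) rfl
  · have hT : i ∈ T := by tauto
    simp only [proj, hT, if_true]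
    exact SplitAlgebra.ext rfl (hx.2 i hi)

theorem proj_eq_self {n : ℕ} {S : Finset (Fin n)} {x : Fin n → SplitAlgebra A M}
    (hx : HasType S x) (i : Fin n) : proj (k := k) S i (x i) = x i := by
  by_cases hi : i ∈ S
  · simp only [proj, hi, if_true]
    exact SplitAlgebra.ext (hx.1 i hi).symm rfl
  · simp only [proj, hi, if_false]
    exact SplitAlgebra.ext rfl (hx.2 i hi).symm

/-- On tensors with exactly `p` entries in `M` the `p`-component of `f` agrees with `f`. -/
theorem component_of_card_eq {p n : ℕ} (f : Cochain k (SplitAlgebra A M) X n)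
    {S : Finset (Fin n)} {x : Fin n → SplitAlgebra A M} (hx : HasType S x) (hS : S.card = p) :
    component p n f x = f x := by
  rw [component_apply, Finset.sum_eq_single S]
  · congr 1; funext i; exact proj_eq_self hx i
  · intro T _ hT
    obtain ⟨i, hi⟩ : ∃ i, ¬(i ∈ S ↔ i ∈ T) := by
      by_contra! h; exact hT (Finset.ext fun i => (h i).symm)
    exact f.map_coord_zero i (proj_eq_zero hx hi)
  · intro h; exact absurd (mem_powersetCard.2 ⟨subset_univ _, hS⟩) h

theorem component_mem_spot (p n : ℕ) (f : Cochain k (SplitAlgebra A M) X n) :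
    component p n f ∈ spot k A M X p n := by
  intro S x hS hx
  rw [component_apply]
  refine Finset.sum_eq_zero fun T hT => ?_
  obtain ⟨i, hi⟩ : ∃ i, ¬(i ∈ S ↔ i ∈ T) := by
    by_contra! h
    exact hS (by rw [Finset.ext h]; exact (mem_powersetCard.1 hT).2)
  exact f.map_coord_zero i (proj_eq_zero hx hi)

/-- A cochain vanishing on all tensors with fewer than `p` entries in `M`. -/
def VanishesBelow (p n : ℕ) (f : Cochain k (SplitAlgebra A M) X n) : Prop :=
  ∀ (S : Finset (Fin n)) (x : Fin n → SplitAlgebra A M),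
    S.card < p → (∀ i ∉ S, (x i).2 = 0) → f x = 0

theorem vanishesBelow_of_hasType {p n : ℕ} {f : Cochain k (SplitAlgebra A M) X n}
    (h : ∀ (S : Finset (Fin n)) (x : Fin n → SplitAlgebra A M),
      S.card < p → HasType S x → f x = 0) : VanishesBelow p n f := by
  intro S x hS hx
  have hsum : x = (fun i => projM k A M (x i)) + (fun i => projA k A M (x i)) := by
    funext i
    exact SplitAlgebra.ext (zero_add _).symm (add_zero _).symm
  rw [hsum, f.map_add_univ]
  refine Finset.sum_eq_zero fun T _ => ?_
  by_cases hT : T ⊆ S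
  · refine h T _ (lt_of_le_of_lt (card_le_card hT) hS) ⟨fun i hi => ?_, fun i hi => ?_⟩
    · rw [Finset.piecewise_eq_of_mem _ _ _ hi]; rfl
    · rw [Finset.piecewise_eq_of_notMem _ _ _ hi]; rfl
  · obtain ⟨i, hiT, hiS⟩ := Finset.not_subset.1 hT
    refine f.map_coord_zero i ?_
    rw [Finset.piecewise_eq_of_mem _ _ _ hiT]
    exact SplitAlgebra.ext rfl (hx i hiS)

theorem VanishesBelow.component_eq_zero {p n : ℕ} {f : Cochain k (SplitAlgebra A M) X n}
    (hf : VanishesBelow (p + 1) n f) : component p n f = 0 := by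
  ext x
  rw [component_apply]
  refine Finset.sum_eq_zero fun T hT => ?_
  exact hf T _ (by rw [(mem_powersetCard.1 hT).2]; omega) (hasType_proj T x).2

theorem VanishesBelow.d {p n : ℕ} {f : Cochain k (SplitAlgebra A M) X n}
    (hf : VanishesBelow p n f) : VanishesBelow p (n + 1) (Hochschild.d n f) := by
  intro S x hS hx
  rw [d_apply]
  have h₁ : f (Fin.tail x) = 0 := by
    refine hf (univ.filter fun i => i.succ ∈ S) _ (lt_of_le_of_lt ?_ hS) fun i hi => ?_
    · exact card_le_card_of_injOn Fin.succ (fun i hi => by simpa using hi)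
        (Fin.succ_injective n).injOn
    · exact hx i.succ (by simpa using hi)
  have h₂ : f (Fin.init x) = 0 := by
    refine hf (univ.filter fun i => i.castSucc ∈ S) _ (lt_of_le_of_lt ?_ hS) fun i hi => ?_
    · exact card_le_card_of_injOn Fin.castSucc (fun i hi => by simpa using hi)
        (Fin.castSucc_injective n).injOn
    · exact hx i.castSucc (by simpa using hi)
  have h₃ : ∀ j : Fin n, f (Fin.contractNth j.castSucc (· * ·) x) = 0 := fun j => by
    refine hf (S.image (Fin.predAbove j)) _ (lt_of_le_of_lt card_image_le hS) fun i hi => ?_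
    have hi' : ∀ s, Fin.predAbove j s = i → (x s).2 = 0 := fun s hs => hx s fun hsS =>
      hi (mem_image.2 ⟨s, hsS, hs⟩)
    rcases lt_trichotomy (i : ℕ) j with h | h | h
    · rw [Fin.contractNth_apply_of_lt _ _ _ _ h]
      refine hi' _ ?_
      rw [Fin.predAbove_of_le_castSucc _ _ (Fin.le_def.2 (by simpa using h.le)),
        Fin.castPred_castSucc]
    · obtain rfl : i = j := Fin.ext h
      rw [Fin.contractNth_apply_of_eq _ _ _ _ (by simp), snd_mul, hi' i.castSucc (by simp),
        hi' i.succ (by simp)]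
      simp
    · rw [Fin.contractNth_apply_of_gt _ _ _ _ h]
      refine hi' _ ?_
      rw [Fin.predAbove_of_castSucc_lt _ _ (Fin.lt_def.2 (by simp only [Fin.val_castSucc, Fin.val_succ]; omega)),
        Fin.pred_succ]
  simp [h₁, h₂, h₃]

variable (k A M X)

/-- The vertical differential `d_v : Hom_k(M^{p,q}, X) → Hom_k(M^{p,q+1}, X)`: the component of the
Hochschild coboundary with exactly `p` entries in `M`. -/
def dv (p q : ℕ) : spot k A M X p (p + q) →ₗ[k] spot k A M X p (p + (q + 1)) :=
  ((component p (p + q + 1) ∘ₗ Hochschild.d (p + q)) ∘ₗ (spot k A M X p (p + q)).subtype).codRestrict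
    (spot k A M X p (p + q + 1)) (fun _ => component_mem_spot p (p + q + 1) _)

theorem dv_dv (p q : ℕ) : dv k A M X p (q + 1) ∘ₗ dv k A M X p q = 0 := by
  refine LinearMap.ext fun f => Subtype.ext ?_
  obtain ⟨f, hf⟩ := f
  change component p (p + q + 1 + 1) (Hochschild.d (p + q + 1)
    (component p (p + q + 1) (Hochschild.d (p + q) f))) = 0
  have hfV : VanishesBelow p (p + q) f :=
    vanishesBelow_of_hasType fun S x hS hx => hf S x hS.ne hx
  have key : VanishesBelow (p + 1) (p + q + 1)
      (Hochschild.d (p + q) f - component p (p + q + 1) (Hochschild.d (p + q) f)) := by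
    refine vanishesBelow_of_hasType fun S x hS hx => ?_
    rw [sub_apply]
    rcases Nat.lt_succ_iff_lt_or_eq.1 hS with h | h
    · rw [hfV.d S x h hx.2, component_mem_spot _ _ _ S x h.ne hx, sub_zero]
    · rw [component_of_card_eq _ hx h, sub_self]
  have h := key.d.component_eq_zero
  rw [map_sub, map_sub, d_d, map_zero, zero_sub, neg_eq_zero] at h
  exact h

/-- The `p`-th column of the double complex; its term in degree `q` is `Hom_k(M^{p,q}, X)`. -/
def column (p : ℕ) : CochainComplex (ModuleCat.{u} k) ℕ :=
  CochainComplex.of (fun q => ModuleCat.of k (spot k A M X p (p + q)))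
    (fun q => ModuleCat.ofHom (dv k A M X p q))
    (fun q => by rw [← ModuleCat.ofHom_comp, dv_dv]; rfl)

end Column

end SplitAlgebra

/-! ### Bimodules and their tensor products over a noncommutative algebra -/

/-- `A`-bimodules on which the ground field `k` acts centrally. -/
structure AlgBimodule (k : Type v) [Field k] (A : Type u) [Ring A] [Algebra k A] where
  /-- The underlying type. -/
  carrier : Type u
  [addCommGroup : AddCommGroup carrier]
  [moduleBase : Module k carrier]
  [moduleLeft : Module A carrier]
  [moduleRight : Module Aᵐᵒᵖ carrier]
  [smulComm : SMulCommClass A Aᵐᵒᵖ carrier]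
  [towerLeft : IsScalarTower k A carrier]
  [towerRight : IsScalarTower k Aᵐᵒᵖ carrier]

namespace AlgBimodule

attribute [instance] addCommGroup moduleBase moduleLeft moduleRight smulComm towerLeft towerRight

section Tensor

variable (k : Type v) [Field k] (A : Type u) [Ring A] [Algebra k A]
variable (M N : Type u)
  [AddCommGroup M] [Module k M] [Module A M] [Module Aᵐᵒᵖ M] [SMulCommClass A Aᵐᵒᵖ M]
  [IsScalarTower k A M] [IsScalarTower k Aᵐᵒᵖ M]
  [AddCommGroup N] [Module k N] [Module A N] [Module Aᵐᵒᵖ N] [SMulCommClass A Aᵐᵒᵖ N]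
  [IsScalarTower k A N] [IsScalarTower k Aᵐᵒᵖ N]

/-- The subspace of `M ⊗_k N` spanned by the elements `m a ⊗ n - m ⊗ a n`. -/
def balancedRel : Submodule k (M ⊗[k] N) :=
  Submodule.span k {t | ∃ (m : M) (a : A) (n : N), t = (op a • m) ⊗ₜ[k] n - m ⊗ₜ[k] (a • n)}

/-- The tensor product `M ⊗_A N` over the noncommutative algebra `A`, as a quotient of
`M ⊗_k N`. -/
def BalancedTensor : Type u := (M ⊗[k] N) ⧸ balancedRel k A M N

instance : AddCommGroup (BalancedTensor k A M N) :=
  inferInstanceAs (AddCommGroup ((M ⊗[k] N) ⧸ balancedRel k A M N))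

instance : Module k (BalancedTensor k A M N) :=
  inferInstanceAs (Module k ((M ⊗[k] N) ⧸ balancedRel k A M N))

/-- The class of `m ⊗ n`. -/
def tmul (m : M) (n : N) : BalancedTensor k A M N := (balancedRel k A M N).mkQ (m ⊗ₜ[k] n)

variable {k A M N} in
theorem balanced_hom_ext {f g : BalancedTensor k A M N →ₗ[k] BalancedTensor k A M N}
    (h : ∀ m n, f (tmul k A M N m n) = g (tmul k A M N m n)) : f = g :=
  Submodule.linearMap_qext _ (TensorProduct.ext' h)

/-- The left action of `a`: `a (m ⊗ n) = a m ⊗ n`. -/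
def leftMul (a : A) : BalancedTensor k A M N →ₗ[k] BalancedTensor k A M N :=
  Submodule.mapQ (balancedRel k A M N) (balancedRel k A M N)
    (TensorProduct.map (Algebra.lsmul k k M a) LinearMap.id) (by
      refine Submodule.span_le.2 ?_
      rintro _ ⟨m, b, n, rfl⟩
      refine Submodule.subset_span ⟨a • m, b, n, ?_⟩
      simp [smul_comm a])

/-- The right action of `a`: `(m ⊗ n) a = m ⊗ n a`. -/
def rightMul (a : Aᵐᵒᵖ) : BalancedTensor k A M N →ₗ[k] BalancedTensor k A M N :=
  Submodule.mapQ (balancedRel k A M N) (balancedRel k A M N)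
    (TensorProduct.map LinearMap.id (Algebra.lsmul k k N a)) (by
      refine Submodule.span_le.2 ?_
      rintro _ ⟨m, b, n, rfl⟩
      refine Submodule.subset_span ⟨m, b, a • n, ?_⟩
      simp [smul_comm b])

@[simp] theorem leftMul_tmul (a : A) (m : M) (n : N) :
    leftMul k A M N a (tmul k A M N m n) = tmul k A M N (a • m) n := rfl

@[simp] theorem rightMul_tmul (a : Aᵐᵒᵖ) (m : M) (n : N) :
    rightMul k A M N a (tmul k A M N m n) = tmul k A M N m (a • n) := rfl

theorem tmul_add_left (m m' : M) (n : N) :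
    tmul k A M N (m + m') n = tmul k A M N m n + tmul k A M N m' n := by
  simp only [tmul, TensorProduct.add_tmul, map_add]; rfl

theorem tmul_add_right (m : M) (n n' : N) :
    tmul k A M N m (n + n') = tmul k A M N m n + tmul k A M N m n' := by
  simp only [tmul, TensorProduct.tmul_add, map_add]; rfl

theorem tmul_smul_left (c : k) (m : M) (n : N) :
    tmul k A M N (c • m) n = c • tmul k A M N m n := by
  simp only [tmul, ← TensorProduct.smul_tmul', map_smul]; rfl

theorem tmul_smul_right (c : k) (m : M) (n : N) :
    tmul k A M N m (c • n) = c • tmul k A M N m n := by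
  simp only [tmul, TensorProduct.tmul_smul, map_smul]; rfl

/-- The left action as a homomorphism of algebras. -/
def leftHom : A →ₐ[k] Module.End k (BalancedTensor k A M N) :=
  AlgHom.ofLinearMap
    { toFun := leftMul k A M N
      map_add' := fun a b => balanced_hom_ext fun m n => by
        simp [add_smul, tmul_add_left]
      map_smul' := fun c a => balanced_hom_ext fun m n => by
        simp [tmul_smul_left] }
    (balanced_hom_ext fun m n => by simp)
    (fun a b => balanced_hom_ext fun m n => by simp [mul_smul])

/-- The right action as a homomorphism of algebras. -/
def rightHom : Aᵐᵒᵖ →ₐ[k] Module.End k (BalancedTensor k A M N) :=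
  AlgHom.ofLinearMap
    { toFun := rightMul k A M N
      map_add' := fun a b => balanced_hom_ext fun m n => by
        simp [add_smul, tmul_add_right]
      map_smul' := fun c a => balanced_hom_ext fun m n => by
        simp [tmul_smul_right] }
    (balanced_hom_ext fun m n => by simp)
    (fun a b => balanced_hom_ext fun m n => by simp [mul_smul])

instance : Module A (BalancedTensor k A M N) :=
  Module.compHom _ (leftHom k A M N).toRingHom

instance : Module Aᵐᵒᵖ (BalancedTensor k A M N) :=
  Module.compHom _ (rightHom k A M N).toRingHom

theorem smul_def (a : A) (t : BalancedTensor k A M N) : a • t = leftMul k A M N a t := rfl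

theorem op_smul_def (a : Aᵐᵒᵖ) (t : BalancedTensor k A M N) : a • t = rightMul k A M N a t := rfl

instance : IsScalarTower k A (BalancedTensor k A M N) :=
  ⟨fun c a t => LinearMap.congr_fun (map_smul (leftHom k A M N) c a) t⟩

instance : IsScalarTower k Aᵐᵒᵖ (BalancedTensor k A M N) :=
  ⟨fun c a t => LinearMap.congr_fun (map_smul (rightHom k A M N) c a) t⟩

instance : SMulCommClass A Aᵐᵒᵖ (BalancedTensor k A M N) :=
  ⟨fun a b t => LinearMap.congr_fun (balanced_hom_ext
    (f := leftMul k A M N a ∘ₗ rightMul k A M N b)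
    (g := rightMul k A M N b ∘ₗ leftMul k A M N a) fun m n => by simp) t⟩

end Tensor

variable {k : Type v} [Field k] {A : Type u} [Ring A] [Algebra k A]

/-- `M ⊗_A N` as an `A`-bimodule. -/
def tensor (M N : AlgBimodule k A) : AlgBimodule k A := ⟨BalancedTensor k A M.carrier N.carrier⟩

/-- The tensor powers `M^{⊗_A p}`, with `M^{⊗_A 0} = A` and
`M^{⊗_A (p+1)} = M ⊗_A M^{⊗_A p}`. -/
def tensorPower (M : AlgBimodule k A) : ℕ → AlgBimodule k A
  | 0 => ⟨A⟩
  | p + 1 => M.tensor (M.tensorPower p)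

/-- Restriction of scalars along a homomorphism of algebras, on both sides. -/
def restrictScalars {B : Type u} [Ring B] [Algebra k B] (f : A →ₐ[k] B) (X : AlgBimodule k B) :
    AlgBimodule k A :=
  letI : Module A X.carrier := Module.compHom X.carrier f.toRingHom
  letI : Module Aᵐᵒᵖ X.carrier := Module.compHom X.carrier (AlgHom.op f).toRingHom
  haveI : SMulCommClass A Aᵐᵒᵖ X.carrier :=
    ⟨fun a b x => smul_comm (f a) (AlgHom.op f b) x⟩
  haveI : IsScalarTower k A X.carrier := ⟨fun c a x => by
    change f (c • a) • x = c • f a • x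
    rw [map_smul, smul_assoc]⟩
  haveI : IsScalarTower k Aᵐᵒᵖ X.carrier := ⟨fun c a x => by
    change AlgHom.op f (c • a) • x = c • AlgHom.op f a • x
    rw [map_smul, smul_assoc]⟩
  ⟨X.carrier⟩

/-- An `A`-bimodule as a module over the enveloping algebra `A ⊗_k Aᵒᵖ`, with
`(a ⊗ b) x = a x b`; `Ext_{A-A}` is `Ext` in this module category. -/
def toModuleCat (M : AlgBimodule k A) : ModuleCat.{u} (A ⊗[k] Aᵐᵒᵖ) :=
  letI : Module (A ⊗[k] Aᵐᵒᵖ) M.carrier := TensorProduct.Algebra.module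
  ModuleCat.of (A ⊗[k] Aᵐᵒᵖ) M.carrier

end AlgBimodule

end

/-! A cochain in `Hom_k(M^{p,q}, X)` vanishes on words with fewer than `p` entries in `M`. When its
coboundary is evaluated on a word with exactly `p` such entries, each term that uses a product
`m.m'` or an action of `M` on `X` feeds the cochain a word with fewer entries in `M`, so it
vanishes. Hence `d_v` only sees the `A`-bimodules `M` and `X`: the column is the part of weight `p`
of the Hochschild complex of the trivial extension of `A` by `M`, with `M` acting by zero on the
coefficients (`spotEquiv_d`, `columnIso`). There the whole coboundary preserves the weight.

This weight complex is a functor of the coefficient bimodule `N`, and it computes `Ext(T, N)` for `T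
= M^{⊗_A p}` by dimension shifting (`nonempty_homology_linearEquiv`), given three facts. It is
exact, because short exact sequences split over the field `k`. Its cohomology in degree `0` is
`Hom(T, N)`, naturally in `N`: a cocycle of weight `p` in degree `p` is a multilinear map on `M`
that is `A`-balanced between neighbours and `A`-linear at both ends (`exists_tensorPower_hom`). It
is acyclic in positive degrees when `N` is injective (`weightAcyclic_of_injective`).

Projectivity enters in the last fact. An injective bimodule is a retract of a coinduced one,
`Hom_k(A, Y)`. The homotopy `f ↦ f(a, -)(1)` reduces weight `p + 1` with coefficients `Hom_k(A, Y)`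
to weight `p` with coefficients `Hom_k(M, Y)`. If `M` is projective as a right module, it is a
summand of a sum of copies of `A` indexed by `M`, so `Hom_k(M, Y)` is a retract of `Hom_k(A, Y^M)`
and induction on `p` applies. If `M` is projective on the left, the mirror argument removes the last
variable instead of the first. -/

noncomputable section

/-! ### The Hochschild coboundary with its first or last variable separated. -/

namespace Hochschild

section Parts

variable {k : Type v} [Field k] {B : Type u} [Ring B] [Algebra k B]

/-- The multilinear map with values in `V →ₗ[k] Y` obtained from a linear family of multilinear
maps. -/
def flipMultilinear {n : ℕ} {V Y : Type u} [AddCommGroup V] [Module k V] [AddCommGroup Y]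
    [Module k Y] (L : V →ₗ[k] Cochain k B Y n) :
    MultilinearMap k (fun _ : Fin n => B) (V →ₗ[k] Y) where
  toFun w :=
    { toFun := fun v => L v w
      map_add' := fun _ _ => by simp
      map_smul' := fun _ _ => by simp }
  map_update_add' w i a b := by ext; simp
  map_update_smul' w i c a := by ext; simp

@[simp] theorem flipMultilinear_apply {n : ℕ} {V Y : Type u} [AddCommGroup V] [Module k V]
    [AddCommGroup Y] [Module k Y] (L : V →ₗ[k] Cochain k B Y n) (w : Fin n → B) (v : V) :
    flipMultilinear L w v = L v w := rfl

section Right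

variable {X X' : Type u} [AddCommGroup X] [Module k X] [Module Bᵐᵒᵖ X]
  [AddCommGroup X'] [Module k X'] [Module Bᵐᵒᵖ X']

/-- The terms of the Hochschild coboundary not involving the left action. -/
def rightPart {n : ℕ} (f : Cochain k B X n) (w : Fin (n + 1) → B) : X :=
  ∑ j : Fin n, (-1 : k) ^ ((j : ℕ) + 1) • f (Fin.contractNth j.castSucc (· * ·) w) +
    (-1 : k) ^ (n + 1) • op (w (Fin.last n)) • f (Fin.init w)

/-- Needed for evaluation maps on coinduced bimodules, which are linear for one of the two actions
only. -/
theorem map_rightPart {n : ℕ} (φ : X →ₗ[k] X') (hφ : ∀ (b : B) x, φ (op b • x) = op b • φ x)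
    (f : Cochain k B X n) (w : Fin (n + 1) → B) :
    φ (rightPart f w) = rightPart (φ.compMultilinearMap f) w := by
  simp [rightPart, hφ]

end Right

section Left

variable {X X' : Type u} [AddCommGroup X] [Module k X] [Module B X]
  [AddCommGroup X'] [Module k X'] [Module B X']

/-- The terms of the Hochschild coboundary not involving the right action. -/
def leftPart {n : ℕ} (f : Cochain k B X n) (w : Fin (n + 1) → B) : X :=
  w 0 • f (Fin.tail w) +
    ∑ j : Fin n, (-1 : k) ^ ((j : ℕ) + 1) • f (Fin.contractNth j.castSucc (· * ·) w)

theorem map_leftPart {n : ℕ} (φ : X →ₗ[k] X') (hφ : ∀ (b : B) x, φ (b • x) = b • φ x)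
    (f : Cochain k B X n) (w : Fin (n + 1) → B) :
    φ (leftPart f w) = leftPart (φ.compMultilinearMap f) w := by
  simp [leftPart, hφ]

end Left

variable {X X' : Type u} [AddCommGroup X] [Module k X] [Module B X] [Module Bᵐᵒᵖ X]
  [SMulCommClass B Bᵐᵒᵖ X] [IsScalarTower k B X] [IsScalarTower k Bᵐᵒᵖ X]
  [AddCommGroup X'] [Module k X'] [Module B X'] [Module Bᵐᵒᵖ X']
  [SMulCommClass B Bᵐᵒᵖ X'] [IsScalarTower k B X'] [IsScalarTower k Bᵐᵒᵖ X']

theorem d_eq_add_rightPart {n : ℕ} (f : Cochain k B X n) (w : Fin (n + 1) → B) :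
    d n f w = w 0 • f (Fin.tail w) + rightPart f w := by
  rw [d_apply, rightPart, add_assoc]

theorem d_eq_leftPart_add {n : ℕ} (f : Cochain k B X n) (w : Fin (n + 1) → B) :
    d n f w = leftPart f w + (-1 : k) ^ (n + 1) • op (w (Fin.last n)) • f (Fin.init w) := by
  rw [d_apply, leftPart]

theorem map_d {n : ℕ} (φ : X →ₗ[k] X') (hφ : ∀ (b : B) x, φ (b • x) = b • φ x)
    (hφ' : ∀ (b : B) x, φ (op b • x) = op b • φ x) (f : Cochain k B X n) :
    φ.compMultilinearMap (d n f) = d n (φ.compMultilinearMap f) := by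
  ext w
  simp [d_apply, hφ, hφ']

/-- Only two terms move `x`. In the others `x` stays in front as a parameter and every position
shifts by one, which accounts for the minus sign before `rightPart`. -/
theorem d_cons {n : ℕ} (f : Cochain k B X (n + 1)) (x : B) (w : Fin (n + 1) → B) :
    d (n + 1) f (Fin.cons x w : Fin (n + 2) → B) =
      x • f w - f (Fin.cons (x * w 0) (Fin.tail w) : Fin (n + 1) → B) -
        rightPart (f.curryLeft x) w := by
  rw [d_apply, Fin.sum_univ_succ, rightPart]
  have h₀ : Fin.contractNth (0 : Fin (n + 1)).castSucc (· * ·) (Fin.cons x w : Fin (n + 2) → B) =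
      Fin.cons (x * w 0) (Fin.tail w) := by
    funext l
    refine Fin.cases ?_ (fun l => ?_) l
    · rw [Fin.contractNth_apply_of_eq _ _ _ _ (by simp)]; rfl
    · rw [Fin.contractNth_apply_of_gt _ _ _ _ (by simp)]; rfl
  have h₁ : ∀ j : Fin n, Fin.contractNth j.succ.castSucc (· * ·) (Fin.cons x w : Fin (n + 2) → B) =
      Fin.cons x (Fin.contractNth j.castSucc (· * ·) w) := by
    intro j
    funext l
    refine Fin.cases ?_ (fun l => ?_) l
    · rw [Fin.contractNth_apply_of_lt _ _ _ _ (by simp)]; rfl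
    · rw [Fin.cons_succ]
      rcases lt_trichotomy (l : ℕ) j with h | h | h
      · rw [Fin.contractNth_apply_of_lt _ _ _ _ (by simpa using h),
          Fin.contractNth_apply_of_lt _ _ _ _ (by simpa using h), ← Fin.succ_castSucc,
          Fin.cons_succ]
      · rw [Fin.contractNth_apply_of_eq _ _ _ _ (by simpa using h),
          Fin.contractNth_apply_of_eq _ _ _ _ (by simpa using h), ← Fin.succ_castSucc,
          Fin.cons_succ, Fin.cons_succ]
      · rw [Fin.contractNth_apply_of_gt _ _ _ _ (by simpa using h),
          Fin.contractNth_apply_of_gt _ _ _ _ (by simpa using h), Fin.cons_succ]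
  have h₂ : Fin.init (Fin.cons x w : Fin (n + 2) → B) = Fin.cons x (Fin.init w) := by
    funext l
    refine Fin.cases rfl (fun l => rfl) l
  simp only [h₀, h₁, h₂, Fin.cons_zero, Fin.tail_cons, Fin.val_zero, zero_add, pow_one, neg_smul,
    one_smul, Fin.val_succ, MultilinearMap.curryLeft_apply, ← Fin.succ_last, Fin.cons_succ]
  have h₃ : ∀ m : ℕ, (-1 : k) ^ (m + 1 + 1) = -(-1) ^ (m + 1) := fun m => by ring
  simp only [h₃, neg_smul, Finset.sum_neg_distrib]
  abel

/-- The cochain `w ↦ f (w, x)`. -/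
def curryLast {n : ℕ} (f : Cochain k B X (n + 1)) : B →ₗ[k] Cochain k B X n where
  toFun x := (LinearMap.applyₗ x).compMultilinearMap f.curryRight
  map_add' x y := by ext; simp
  map_smul' c x := by ext; simp

@[simp] theorem curryLast_apply {n : ℕ} (f : Cochain k B X (n + 1)) (x : B) (w : Fin n → B) :
    curryLast f x w = f (Fin.snoc w x) := rfl

/-- Adding a variable at the end shifts no position, so `leftPart` keeps its sign, in contrast with
`d_cons`. -/
theorem d_snoc {n : ℕ} (f : Cochain k B X (n + 1)) (w : Fin (n + 1) → B) (x : B) :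
    d (n + 1) f (Fin.snoc w x : Fin (n + 2) → B) =
      leftPart (curryLast f x) w + (-1 : k) ^ (n + 1) •
        f (Fin.snoc (Fin.init w) (w (Fin.last n) * x) : Fin (n + 1) → B) -
      (-1 : k) ^ (n + 1) • op x • f w := by
  rw [d_apply, Fin.sum_univ_castSucc, leftPart]
  have h₀ : Fin.contractNth (Fin.last n).castSucc (· * ·) (Fin.snoc w x : Fin (n + 2) → B) =
      Fin.snoc (Fin.init w) (w (Fin.last n) * x) := by
    funext l
    refine Fin.lastCases ?_ (fun l => ?_) l
    · rw [Fin.contractNth_apply_of_eq _ _ _ _ (by simp), Fin.snoc_castSucc, Fin.snoc_last,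
        Fin.succ_last, Fin.snoc_last]
    · rw [Fin.contractNth_apply_of_lt _ _ _ _ (by simp), Fin.snoc_castSucc, Fin.snoc_castSucc]; rfl
  have h₁ : ∀ j : Fin n, Fin.contractNth j.castSucc.castSucc (· * ·)
      (Fin.snoc w x : Fin (n + 2) → B) = Fin.snoc (Fin.contractNth j.castSucc (· * ·) w) x := by
    intro j
    funext l
    refine Fin.lastCases ?_ (fun l => ?_) l
    · rw [Fin.contractNth_apply_of_gt _ _ _ _ (by simp), Fin.succ_last, Fin.snoc_last,
        Fin.snoc_last]
    · rw [Fin.snoc_castSucc]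
      rcases lt_trichotomy (l : ℕ) j with h | h | h
      · rw [Fin.contractNth_apply_of_lt _ _ _ _ (by simpa using h),
          Fin.contractNth_apply_of_lt _ _ _ _ (by simpa using h), Fin.snoc_castSucc]
      · rw [Fin.contractNth_apply_of_eq _ _ _ _ (by simpa using h),
          Fin.contractNth_apply_of_eq _ _ _ _ (by simpa using h), Fin.snoc_castSucc,
          Fin.succ_castSucc, Fin.snoc_castSucc]
      · rw [Fin.contractNth_apply_of_gt _ _ _ _ (by simpa using h),
          Fin.contractNth_apply_of_gt _ _ _ _ (by simpa using h), Fin.succ_castSucc,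
          Fin.snoc_castSucc]
  have h₂ : Fin.tail (Fin.snoc w x : Fin (n + 2) → B) = Fin.snoc (Fin.tail w) x := by
    funext l
    refine Fin.lastCases ?_ (fun l => ?_) l
    · simp [Fin.tail]
    · rw [Fin.snoc_castSucc, Fin.tail, Fin.succ_castSucc, Fin.snoc_castSucc, Fin.tail]
  have h₃ : (Fin.snoc w x : Fin (n + 2) → B) 0 = w 0 := by
    rw [← Fin.castSucc_zero, Fin.snoc_castSucc]
  simp only [h₀, h₁, h₂, h₃, Fin.init_snoc, Fin.snoc_last, Fin.val_castSucc, Fin.val_last,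
    curryLast_apply]
  have h₄ : (-1 : k) ^ (n + 1 + 1) = -(-1) ^ (n + 1) := by ring
  simp only [h₄, neg_smul]
  abel

end Parts

end Hochschild

/-! ### Cochains of the trivial extension, graded by the number of entries in `M`. -/

namespace TrivSqZeroExt

open Hochschild

section Action

variable {A M : Type u} [Ring A] [AddCommGroup M] [Module A M] [Module Aᵐᵒᵖ M]
  [SMulCommClass A Aᵐᵒᵖ M]

/-- The projection of a trivial extension onto its base ring. -/
def fstRingHom : TrivSqZeroExt A M →+* A where
  toFun := fst
  map_one' := rfl
  map_mul' _ _ := rfl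
  map_zero' := rfl
  map_add' _ _ := rfl

variable {X : Type u} [AddCommGroup X]

/-- Through this action `M` kills the coefficients, which is what makes the coboundary homogeneous
for the weight. -/
instance [Module A X] : Module (TrivSqZeroExt A M) X := Module.compHom X fstRingHom

instance [Module Aᵐᵒᵖ X] : Module (TrivSqZeroExt A M)ᵐᵒᵖ X := Module.compHom X fstRingHom.op

theorem smul_eq_fst_smul [Module A X] (b : TrivSqZeroExt A M) (x : X) : b • x = b.fst • x := rfl

theorem op_smul_eq_fst_smul [Module Aᵐᵒᵖ X] (b : TrivSqZeroExt A M) (x : X) :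
    op b • x = op b.fst • x := rfl

instance [Module A X] [Module Aᵐᵒᵖ X] [SMulCommClass A Aᵐᵒᵖ X] :
    SMulCommClass (TrivSqZeroExt A M) (TrivSqZeroExt A M)ᵐᵒᵖ X :=
  ⟨fun b c x => smul_comm b.fst (op c.unop.fst) x⟩

variable {k : Type v} [Field k] [Algebra k A] [Module k M] [IsScalarTower k A M]
  [IsScalarTower k Aᵐᵒᵖ M] [Module k X]

instance [Module A X] [IsScalarTower k A X] : IsScalarTower k (TrivSqZeroExt A M) X :=
  ⟨fun c b x => smul_assoc c b.fst x⟩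

instance [Module Aᵐᵒᵖ X] [IsScalarTower k Aᵐᵒᵖ X] :
    IsScalarTower k (TrivSqZeroExt A M)ᵐᵒᵖ X :=
  ⟨fun c b x => smul_assoc c (op b.unop.fst) x⟩

end Action

section Weight

open Finset

variable (k : Type v) [Field k] (A M : Type u) [Ring A] [Algebra k A] [AddCommGroup M] [Module k M]
  [Module A M] [Module Aᵐᵒᵖ M] [SMulCommClass A Aᵐᵒᵖ M] [IsScalarTower k A M]
  [IsScalarTower k Aᵐᵒᵖ M]

variable {A M} in
/-- The entries of the word `x` at the places in `S` belong to `M`, the other ones to `A`. -/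
def HasType {n : ℕ} (S : Finset (Fin n)) (x : Fin n → TrivSqZeroExt A M) : Prop :=
  (∀ i ∈ S, (x i).fst = 0) ∧ (∀ i ∉ S, (x i).snd = 0)

variable {A M}

theorem HasType.cons_inl {n : ℕ} {S : Finset (Fin n)} {x : Fin n → TrivSqZeroExt A M}
    (hx : HasType S x) (a : A) :
    HasType (S.map (Fin.succEmb n)) (Fin.cons (inl a) x : Fin (n + 1) → TrivSqZeroExt A M) := by
  refine ⟨fun i => ?_, fun i => ?_⟩
  · refine Fin.cases (fun h => ?_) (fun i h => ?_) i
    · simp at h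
    · exact hx.1 i (by simpa using h)
  · refine Fin.cases (fun h => ?_) (fun i h => ?_) i
    · simp
    · exact hx.2 i (by simpa using h)

theorem HasType.cons_inr {n : ℕ} {S : Finset (Fin n)} {x : Fin n → TrivSqZeroExt A M}
    (hx : HasType S x) (m : M) : HasType (insert 0 (S.map (Fin.succEmb n)))
      (Fin.cons (inr m) x : Fin (n + 1) → TrivSqZeroExt A M) := by
  refine ⟨fun i => ?_, fun i => ?_⟩
  · refine Fin.cases (fun h => ?_) (fun i h => ?_) i
    · simp
    · exact hx.1 i (by simpa [Fin.succ_ne_zero] using h)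
  · refine Fin.cases (fun h => ?_) (fun i h => ?_) i
    · simp at h
    · exact hx.2 i (by simpa [Fin.succ_ne_zero] using h)

theorem card_insert_zero_map_succ {n : ℕ} (S : Finset (Fin n)) :
    (insert 0 (S.map (Fin.succEmb n))).card = S.card + 1 := by
  rw [card_insert_of_notMem (by simp [Fin.succ_ne_zero]), card_map]

theorem HasType.snoc_inl {n : ℕ} {S : Finset (Fin n)} {x : Fin n → TrivSqZeroExt A M}
    (hx : HasType S x) (a : A) :
    HasType (S.map Fin.castSuccEmb) (Fin.snoc x (inl a) : Fin (n + 1) → TrivSqZeroExt A M) := by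
  refine ⟨fun i => ?_, fun i => ?_⟩
  · refine Fin.lastCases (fun h => ?_) (fun i h => ?_) i
    · simp [Fin.castSucc_ne_last] at h
    · rw [Fin.snoc_castSucc]; exact hx.1 i (by simpa using h)
  · refine Fin.lastCases (fun h => ?_) (fun i h => ?_) i
    · simp
    · rw [Fin.snoc_castSucc]; exact hx.2 i (by simpa using h)

theorem HasType.snoc_inr {n : ℕ} {S : Finset (Fin n)} {x : Fin n → TrivSqZeroExt A M}
    (hx : HasType S x) (m : M) : HasType (insert (Fin.last n) (S.map Fin.castSuccEmb))
      (Fin.snoc x (inr m) : Fin (n + 1) → TrivSqZeroExt A M) := by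
  refine ⟨fun i => ?_, fun i => ?_⟩
  · refine Fin.lastCases (fun h => ?_) (fun i h => ?_) i
    · simp
    · rw [Fin.snoc_castSucc]; exact hx.1 i (by simpa [Fin.castSucc_ne_last] using h)
  · refine Fin.lastCases (fun h => ?_) (fun i h => ?_) i
    · simp at h
    · rw [Fin.snoc_castSucc]; exact hx.2 i (by simpa [Fin.castSucc_ne_last] using h)

theorem card_insert_last_map_castSucc {n : ℕ} (S : Finset (Fin n)) :
    (insert (Fin.last n) (S.map Fin.castSuccEmb)).card = S.card + 1 := by
  rw [card_insert_of_notMem (by simp [Fin.castSucc_ne_last]), card_map]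

theorem HasType.tail {n : ℕ} {S : Finset (Fin (n + 1))} {x : Fin (n + 1) → TrivSqZeroExt A M}
    (hx : HasType S x) : HasType (univ.filter fun i => i.succ ∈ S) (Fin.tail x) :=
  ⟨fun i hi => hx.1 i.succ (by simpa using hi), fun i hi => hx.2 i.succ (by simpa using hi)⟩

theorem card_filter_succ_mem {n : ℕ} (S : Finset (Fin (n + 1))) :
    S.card = (univ.filter fun i : Fin n => i.succ ∈ S).card + if 0 ∈ S then 1 else 0 := by
  conv_lhs => rw [← filter_univ_mem S, Fin.card_filter_univ_succ]
  split_ifs <;> rfl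

theorem HasType.init {n : ℕ} {S : Finset (Fin (n + 1))} {x : Fin (n + 1) → TrivSqZeroExt A M}
    (hx : HasType S x) : HasType (univ.filter fun i => i.castSucc ∈ S) (Fin.init x) :=
  ⟨fun i hi => hx.1 i.castSucc (by simpa using hi),
    fun i hi => hx.2 i.castSucc (by simpa using hi)⟩

theorem card_filter_castSucc_mem {n : ℕ} (S : Finset (Fin (n + 1))) :
    S.card = (univ.filter fun i : Fin n => i.castSucc ∈ S).card +
      if Fin.last n ∈ S then 1 else 0 := by
  conv_lhs => rw [← filter_univ_mem S, Fin.univ_castSuccEmb, filter_cons]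
  split_ifs with h
  · rw [card_cons, filter_map, card_map]; rfl
  · rw [filter_map, card_map]; rfl

theorem val_predAbove {n : ℕ} (j : Fin n) (s : Fin (n + 1)) :
    (Fin.predAbove j s : ℕ) = if (j : ℕ) < s then (s : ℕ) - 1 else s := by
  rw [Fin.predAbove]
  split_ifs with h h' h' <;> simp only [Fin.lt_def, Fin.val_castSucc] at h <;>
    first | rfl | omega

/-- A product of entries that are not both in `M` lies in `M` as soon as one of them does, so the
places in `M` are carried along by `Fin.predAbove j`. -/
theorem HasType.contractNth {n : ℕ} {S : Finset (Fin (n + 1))}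
    {x : Fin (n + 1) → TrivSqZeroExt A M} (hx : HasType S x) (j : Fin n)
    (hj : ¬(j.castSucc ∈ S ∧ j.succ ∈ S)) :
    HasType (S.image (Fin.predAbove j)) (Fin.contractNth j.castSucc (· * ·) x) := by
  refine ⟨fun i hi => ?_, fun i hi => ?_⟩
  · obtain ⟨s, hs, rfl⟩ := mem_image.1 hi
    have hv := val_predAbove j s
    rcases lt_trichotomy (Fin.predAbove j s : ℕ) j with h | h | h
    · rw [Fin.contractNth_apply_of_lt _ _ _ _ h]
      convert hx.1 s hs
      ext
      simp only [Fin.val_castSucc]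
      split_ifs at hv <;> omega
    · rw [Fin.contractNth_apply_of_eq _ _ _ _ (by simpa using h), fst_mul, Fin.ext h]
      have : s = j.castSucc ∨ s = j.succ := by
        simp only [Fin.ext_iff, Fin.val_castSucc, Fin.val_succ]
        split_ifs at hv <;> omega
      rcases this with rfl | rfl
      · rw [hx.1 _ hs, zero_mul]
      · rw [hx.1 _ hs, mul_zero]
    · rw [Fin.contractNth_apply_of_gt _ _ _ _ h]
      convert hx.1 s hs
      ext
      simp only [Fin.val_succ]
      split_ifs at hv <;> omega
  · have hi' : ∀ s, Fin.predAbove j s = i → (x s).snd = 0 := fun s hs => hx.2 s fun hsS =>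
      hi (mem_image.2 ⟨s, hsS, hs⟩)
    rcases lt_trichotomy (i : ℕ) j with h | h | h
    · rw [Fin.contractNth_apply_of_lt _ _ _ _ h]
      refine hi' _ (Fin.ext ?_)
      rw [val_predAbove, if_neg (by simp only [Fin.val_castSucc]; omega), Fin.val_castSucc]
    · obtain rfl : i = j := Fin.ext h
      rw [Fin.contractNth_apply_of_eq _ _ _ _ (by simp), snd_mul, hi' i.castSucc (by simp),
        hi' i.succ (by simp)]
      simp
    · rw [Fin.contractNth_apply_of_gt _ _ _ _ h]
      refine hi' _ (Fin.ext ?_)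
      rw [val_predAbove, if_pos (by simp only [Fin.val_succ]; omega), Fin.val_succ,
        Nat.add_sub_cancel]

/-- The only two places identified by `Fin.predAbove j` are `j.castSucc` and `j.succ`. -/
theorem card_image_predAbove {n : ℕ} {S : Finset (Fin (n + 1))} (j : Fin n)
    (hj : ¬(j.castSucc ∈ S ∧ j.succ ∈ S)) : (S.image (Fin.predAbove j)).card = S.card := by
  refine card_image_of_injOn fun s hs t ht hst => ?_
  have h := congrArg Fin.val hst
  rw [val_predAbove, val_predAbove] at h
  by_contra hne
  have hne' : (s : ℕ) ≠ t := fun h => hne (Fin.ext h)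
  have : (s = j.castSucc ∧ t = j.succ) ∨ (s = j.succ ∧ t = j.castSucc) := by
    simp only [Fin.ext_iff, Fin.val_castSucc, Fin.val_succ]
    split_ifs at h <;> omega
  rcases this with ⟨rfl, rfl⟩ | ⟨rfl, rfl⟩
  · exact hj ⟨hs, ht⟩
  · exact hj ⟨ht, hs⟩

/-- A multilinear map vanishing on all words with entries in `A` and `M` vanishes. -/
theorem eq_zero_of_hasType {X : Type u} [AddCommGroup X] [Module k X] {n : ℕ}
    {f : Cochain k (TrivSqZeroExt A M) X n}
    (h : ∀ (S : Finset (Fin n)) (x : Fin n → TrivSqZeroExt A M), HasType S x → f x = 0) :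
    f = 0 := by
  ext x
  have hsum : x = (fun i => inr (x i).snd) + (fun i => inl (x i).fst) := by
    funext i
    rw [Pi.add_apply, add_comm, inl_fst_add_inr_snd_eq]
  rw [hsum, f.map_add_univ]
  refine sum_eq_zero fun T _ => h T _ ⟨fun i hi => ?_, fun i hi => ?_⟩
  · rw [piecewise_eq_of_mem _ _ _ hi, fst_inr]
  · rw [piecewise_eq_of_notMem _ _ _ hi, snd_inl]

variable (A M) in
/-- The Hochschild `n`-cochains of the trivial extension of `A` by `M` vanishing on all words with
entries in `A` and `M` that do not have exactly `p` entries in `M`. -/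
def weight (X : Type u) [AddCommGroup X] [Module k X] (p n : ℕ) :
    Submodule k (Cochain k (TrivSqZeroExt A M) X n) where
  carrier := {f | ∀ (S : Finset (Fin n)) (x : Fin n → TrivSqZeroExt A M),
    S.card ≠ p → HasType S x → f x = 0}
  add_mem' hf hg S x hS hx := by simp [hf S x hS hx, hg S x hS hx]
  zero_mem' S x _ _ := by simp
  smul_mem' c f hf S x hS hx := by simp [hf S x hS hx]

variable {k} {X : Type u} [AddCommGroup X] [Module k X]

/-- A word of length `n` has at most `n` entries in `M`. -/
theorem eq_zero_of_mem_weight {p n : ℕ} (h : n < p) {f : Cochain k (TrivSqZeroExt A M) X n}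
    (hf : f ∈ weight k A M X p n) : f = 0 :=
  eq_zero_of_hasType k fun S x hx =>
    hf S x (ne_of_lt (lt_of_le_of_lt (by simpa using card_le_univ S) h)) hx

theorem comp_mem_weight {Y : Type u} [AddCommGroup Y] [Module k Y] (φ : X →ₗ[k] Y) {p n : ℕ}
    {f : Cochain k (TrivSqZeroExt A M) X n} (hf : f ∈ weight k A M X p n) :
    φ.compMultilinearMap f ∈ weight k A M Y p n := fun S x hS hx => by
  simp [hf S x hS hx]

theorem curryLeft_inl_mem_weight {p n : ℕ} {f : Cochain k (TrivSqZeroExt A M) X (n + 1)}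
    (hf : f ∈ weight k A M X p (n + 1)) (a : A) : f.curryLeft (inl a) ∈ weight k A M X p n :=
  fun _ _ hS hx => hf _ _ (by rwa [card_map]) (hx.cons_inl a)

theorem curryLeft_inr_mem_weight {p n : ℕ} {f : Cochain k (TrivSqZeroExt A M) X (n + 1)}
    (hf : f ∈ weight k A M X (p + 1) (n + 1)) (m : M) :
    f.curryLeft (inr m) ∈ weight k A M X p n :=
  fun S _ hS hx => hf _ _ (by rw [card_insert_zero_map_succ]; omega) (hx.cons_inr m)

theorem curryLeft_inr_eq_zero {n : ℕ} {f : Cochain k (TrivSqZeroExt A M) X (n + 1)}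
    (hf : f ∈ weight k A M X 0 (n + 1)) (m : M) : f.curryLeft (inr m) = 0 :=
  eq_zero_of_hasType k fun _ _ hx =>
    hf _ _ (by rw [card_insert_zero_map_succ]; omega) (hx.cons_inr m)

theorem curryLast_inl_mem_weight {p n : ℕ} {f : Cochain k (TrivSqZeroExt A M) X (n + 1)}
    (hf : f ∈ weight k A M X p (n + 1)) (a : A) : curryLast f (inl a) ∈ weight k A M X p n :=
  fun _ _ hS hx => hf _ _ (by rwa [card_map]) (hx.snoc_inl a)

theorem curryLast_inr_mem_weight {p n : ℕ} {f : Cochain k (TrivSqZeroExt A M) X (n + 1)}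
    (hf : f ∈ weight k A M X (p + 1) (n + 1)) (m : M) :
    curryLast f (inr m) ∈ weight k A M X p n :=
  fun S _ hS hx => hf _ _ (by rw [card_insert_last_map_castSucc]; omega) (hx.snoc_inr m)

theorem curryLast_inr_eq_zero {n : ℕ} {f : Cochain k (TrivSqZeroExt A M) X (n + 1)}
    (hf : f ∈ weight k A M X 0 (n + 1)) (m : M) : curryLast f (inr m) = 0 :=
  eq_zero_of_hasType k fun _ _ hx =>
    hf _ _ (by rw [card_insert_last_map_castSucc]; omega) (hx.snoc_inr m)

/-- The terms that could lower the number of entries in `M` involve either `M` acting on `X` or a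
product of two elements of `M`, and both are zero here. -/
theorem d_mem_weight [Module A X] [Module Aᵐᵒᵖ X] [SMulCommClass A Aᵐᵒᵖ X] [IsScalarTower k A X]
    [IsScalarTower k Aᵐᵒᵖ X] {p n : ℕ} {f : Cochain k (TrivSqZeroExt A M) X n}
    (hf : f ∈ weight k A M X p n) : d n f ∈ weight k A M X p (n + 1) := by
  intro S x hS hx
  rw [d_apply]
  have h₁ : x 0 • f (Fin.tail x) = 0 := by
    by_cases h : 0 ∈ S
    · rw [smul_eq_fst_smul, hx.1 0 h, zero_smul]
    · rw [hf _ _ _ hx.tail, smul_zero]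
      rwa [card_filter_succ_mem, if_neg h] at hS
  have h₂ : op (x (Fin.last n)) • f (Fin.init x) = 0 := by
    by_cases h : Fin.last n ∈ S
    · rw [op_smul_eq_fst_smul, hx.1 _ h, op_zero, zero_smul]
    · rw [hf _ _ _ hx.init, smul_zero]
      rwa [card_filter_castSucc_mem, if_neg h] at hS
  have h₃ : ∀ j : Fin n, f (Fin.contractNth j.castSucc (· * ·) x) = 0 := fun j => by
    by_cases h : j.castSucc ∈ S ∧ j.succ ∈ S
    · refine f.map_coord_zero j ?_
      rw [Fin.contractNth_apply_of_eq _ _ _ _ (by simp)]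
      ext
      · simp [hx.1 _ h.1]
      · simp [hx.1 _ h.1, hx.1 _ h.2]
    · exact hf _ _ (by rwa [card_image_predAbove j h]) (hx.contractNth j h)
  simp [h₁, h₂, h₃]

end Weight

end TrivSqZeroExt

/-! ### Coinduced bimodules. -/

/-- Linear maps from a right `A`-module `V` to a right `A`-module `Y`, as an `A`-bimodule with
`(a g b)(v) = g(v a) b`. -/
def LeftCoind (k : Type v) [Field k] (V Y : Type u) [AddCommGroup V] [Module k V] [AddCommGroup Y]
    [Module k Y] : Type u := V →ₗ[k] Y

/-- Linear maps from a left `A`-module `V` to a left `A`-module `Y`, as an `A`-bimodule with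
`(a g b)(v) = a g(b v)`. -/
def RightCoind (k : Type v) [Field k] (V Y : Type u) [AddCommGroup V] [Module k V] [AddCommGroup Y]
    [Module k Y] : Type u := V →ₗ[k] Y

namespace LeftCoind

variable {k : Type v} [Field k] {V Y : Type u} [AddCommGroup V] [Module k V] [AddCommGroup Y]
  [Module k Y]

instance : AddCommGroup (LeftCoind k V Y) := inferInstanceAs (AddCommGroup (V →ₗ[k] Y))
instance : Module k (LeftCoind k V Y) := inferInstanceAs (Module k (V →ₗ[k] Y))
instance : FunLike (LeftCoind k V Y) V Y := inferInstanceAs (FunLike (V →ₗ[k] Y) V Y)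
instance : LinearMapClass (LeftCoind k V Y) k V Y :=
  inferInstanceAs (LinearMapClass (V →ₗ[k] Y) k V Y)

@[ext] theorem ext {f g : LeftCoind k V Y} (h : ∀ v, f v = g v) : f = g := LinearMap.ext h

@[simp] theorem add_apply (f g : LeftCoind k V Y) (v : V) : (f + g) v = f v + g v := rfl
@[simp] theorem sub_apply (f g : LeftCoind k V Y) (v : V) : (f - g) v = f v - g v := rfl
@[simp] theorem smul_apply (c : k) (f : LeftCoind k V Y) (v : V) : (c • f) v = c • f v := rfl

/-- Evaluation at `v`. -/
def eval (v : V) : LeftCoind k V Y →ₗ[k] Y := LinearMap.applyₗ (R := k) v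

@[simp] theorem eval_apply (v : V) (f : LeftCoind k V Y) : eval v f = f v := rfl

variable {A : Type u} [Ring A] [Algebra k A] [Module Aᵐᵒᵖ V] [IsScalarTower k Aᵐᵒᵖ V]
  [Module Aᵐᵒᵖ Y] [IsScalarTower k Aᵐᵒᵖ Y]

instance : Module A (LeftCoind k V Y) where
  smul a f := (f : V →ₗ[k] Y) ∘ₗ Algebra.lsmul k k V (op a)
  one_smul f := ext fun v => congrArg f (one_smul Aᵐᵒᵖ v)
  mul_smul a b f := ext fun v => congrArg f (mul_smul (op b) (op a) v)
  smul_zero _ := rfl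
  smul_add _ _ _ := rfl
  add_smul a b f := ext fun v => (congrArg f (add_smul (op a) (op b) v)).trans (map_add f _ _)
  zero_smul f := ext fun v => (congrArg f (zero_smul Aᵐᵒᵖ v)).trans (map_zero f)

instance : Module Aᵐᵒᵖ (LeftCoind k V Y) where
  smul a f := Algebra.lsmul k k Y a ∘ₗ (f : V →ₗ[k] Y)
  one_smul f := ext fun v => one_smul Aᵐᵒᵖ (f v)
  mul_smul a b f := ext fun v => mul_smul a b (f v)
  smul_zero a := ext fun _ => smul_zero a
  smul_add a f g := ext fun v => smul_add a (f v) (g v)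
  add_smul a b f := ext fun v => add_smul a b (f v)
  zero_smul f := ext fun v => zero_smul Aᵐᵒᵖ (f v)

@[simp] theorem smul_left_apply (a : A) (f : LeftCoind k V Y) (v : V) : (a • f) v = f (op a • v) :=
  rfl

@[simp] theorem smul_right_apply (a : Aᵐᵒᵖ) (f : LeftCoind k V Y) (v : V) :
    (a • f) v = a • f v := rfl

instance : SMulCommClass A Aᵐᵒᵖ (LeftCoind k V Y) := ⟨fun _ _ _ => rfl⟩

instance : IsScalarTower k A (LeftCoind k V Y) :=
  ⟨fun c a f => ext fun v => by simp⟩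

instance : IsScalarTower k Aᵐᵒᵖ (LeftCoind k V Y) :=
  ⟨fun c a f => ext fun v => by simp⟩

end LeftCoind

namespace RightCoind

variable {k : Type v} [Field k] {V Y : Type u} [AddCommGroup V] [Module k V] [AddCommGroup Y]
  [Module k Y]

instance : AddCommGroup (RightCoind k V Y) := inferInstanceAs (AddCommGroup (V →ₗ[k] Y))
instance : Module k (RightCoind k V Y) := inferInstanceAs (Module k (V →ₗ[k] Y))
instance : FunLike (RightCoind k V Y) V Y := inferInstanceAs (FunLike (V →ₗ[k] Y) V Y)
instance : LinearMapClass (RightCoind k V Y) k V Y :=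
  inferInstanceAs (LinearMapClass (V →ₗ[k] Y) k V Y)

@[ext] theorem ext {f g : RightCoind k V Y} (h : ∀ v, f v = g v) : f = g := LinearMap.ext h

@[simp] theorem add_apply (f g : RightCoind k V Y) (v : V) : (f + g) v = f v + g v := rfl
@[simp] theorem smul_apply (c : k) (f : RightCoind k V Y) (v : V) : (c • f) v = c • f v := rfl

/-- Evaluation at `v`. -/
def eval (v : V) : RightCoind k V Y →ₗ[k] Y := LinearMap.applyₗ (R := k) v

@[simp] theorem eval_apply (v : V) (f : RightCoind k V Y) : eval v f = f v := rfl

variable {A : Type u} [Ring A] [Algebra k A] [Module A V] [IsScalarTower k A V]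
  [Module A Y] [IsScalarTower k A Y]

instance : Module A (RightCoind k V Y) where
  smul a f := Algebra.lsmul k k Y a ∘ₗ (f : V →ₗ[k] Y)
  one_smul f := ext fun v => one_smul A (f v)
  mul_smul a b f := ext fun v => mul_smul a b (f v)
  smul_zero a := ext fun _ => smul_zero a
  smul_add a f g := ext fun v => smul_add a (f v) (g v)
  add_smul a b f := ext fun v => add_smul a b (f v)
  zero_smul f := ext fun v => zero_smul A (f v)

instance : Module Aᵐᵒᵖ (RightCoind k V Y) where
  smul a f := (f : V →ₗ[k] Y) ∘ₗ Algebra.lsmul k k V a.unop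
  one_smul f := ext fun v => congrArg f (one_smul A v)
  mul_smul a b f := ext fun v => congrArg f (mul_smul b.unop a.unop v)
  smul_zero _ := rfl
  smul_add _ _ _ := rfl
  add_smul a b f := ext fun v => (congrArg f (add_smul a.unop b.unop v)).trans (map_add f _ _)
  zero_smul f := ext fun v => (congrArg f (zero_smul A v)).trans (map_zero f)

@[simp] theorem smul_left_apply (a : A) (f : RightCoind k V Y) (v : V) : (a • f) v = a • f v :=
  rfl

@[simp] theorem smul_right_apply (a : Aᵐᵒᵖ) (f : RightCoind k V Y) (v : V) :
    (a • f) v = f (a.unop • v) := rfl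

instance : SMulCommClass A Aᵐᵒᵖ (RightCoind k V Y) := ⟨fun _ _ _ => rfl⟩

instance : IsScalarTower k A (RightCoind k V Y) :=
  ⟨fun c a f => ext fun v => by simp⟩

instance : IsScalarTower k Aᵐᵒᵖ (RightCoind k V Y) :=
  ⟨fun c a f => ext fun v => by simp⟩

end RightCoind

/-! ### Fixing or adding one variable of a cochain, and the effect on weights. -/

namespace TrivSqZeroExt

open Hochschild

variable {k : Type v} [Field k] {A M : Type u} [Ring A] [Algebra k A] [AddCommGroup M] [Module k M]
  [Module A M] [Module Aᵐᵒᵖ M] [SMulCommClass A Aᵐᵒᵖ M] [IsScalarTower k A M]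
  [IsScalarTower k Aᵐᵒᵖ M]

variable (k A M) in
/-- The inclusion of `A` in the trivial extension, as a `k`-linear map. -/
def inlₗ : A →ₗ[k] TrivSqZeroExt A M := (inlAlgHom k A M).toLinearMap

variable (k A M) in
/-- The inclusion of `M` in the trivial extension, as a `k`-linear map. -/
def inrₗ : M →ₗ[k] TrivSqZeroExt A M where
  toFun := inr
  map_add' := inr_add A
  map_smul' c m := inr_smul A c m

variable (k A M) in
/-- The projection of the trivial extension onto `M`, as a `k`-linear map. -/
def sndₗ : TrivSqZeroExt A M →ₗ[k] M where
  toFun := snd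
  map_add' _ _ := rfl
  map_smul' _ _ := rfl

@[simp] theorem inlₗ_apply (a : A) : inlₗ k A M a = inl a := rfl
@[simp] theorem inrₗ_apply (m : M) : inrₗ k A M m = inr m := rfl

section Slices

variable {V Y Z : Type u} [AddCommGroup V] [Module k V] [AddCommGroup Y] [Module k Y]
  [AddCommGroup Z] [Module k Z]

/-- The cochain `w ↦ (v ↦ f (ι v, w))`. -/
def firstSlice {n : ℕ} (ι : V →ₗ[k] TrivSqZeroExt A M)
    (f : Cochain k (TrivSqZeroExt A M) Y (n + 1)) :
    Cochain k (TrivSqZeroExt A M) (LeftCoind k V Y) n :=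
  flipMultilinear (f.curryLeft ∘ₗ ι)

@[simp] theorem firstSlice_apply {n : ℕ} (ι : V →ₗ[k] TrivSqZeroExt A M)
    (f : Cochain k (TrivSqZeroExt A M) Y (n + 1)) (w : Fin n → TrivSqZeroExt A M) (v : V) :
    firstSlice ι f w v = f (Fin.cons (ι v) w) := rfl

/-- The cochain `w ↦ (v ↦ f (w, ι v))`. -/
def lastSlice {n : ℕ} (ι : V →ₗ[k] TrivSqZeroExt A M)
    (f : Cochain k (TrivSqZeroExt A M) Y (n + 1)) :
    Cochain k (TrivSqZeroExt A M) (RightCoind k V Y) n :=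
  flipMultilinear (curryLast f ∘ₗ ι)

@[simp] theorem lastSlice_apply {n : ℕ} (ι : V →ₗ[k] TrivSqZeroExt A M)
    (f : Cochain k (TrivSqZeroExt A M) Y (n + 1)) (w : Fin n → TrivSqZeroExt A M) (v : V) :
    lastSlice ι f w v = f (Fin.snoc w (ι v)) := rfl

/-- The cochain `(x, w) ↦ β x (f w)`, where `β` only depends on the component of `x` in `M`. -/
def consMul {n : ℕ} (β : M →ₗ[k] Y →ₗ[k] Z) (f : Cochain k (TrivSqZeroExt A M) Y n) :
    Cochain k (TrivSqZeroExt A M) Z (n + 1) :=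
  LinearMap.uncurryLeft (M := fun _ => TrivSqZeroExt A M)
    { toFun := fun x => (β x.snd).compMultilinearMap f
      map_add' := fun _ _ => by ext; simp
      map_smul' := fun _ _ => by ext; simp }

@[simp] theorem consMul_apply {n : ℕ} (β : M →ₗ[k] Y →ₗ[k] Z)
    (f : Cochain k (TrivSqZeroExt A M) Y n) (w : Fin (n + 1) → TrivSqZeroExt A M) :
    consMul β f w = β (w 0).snd (f (Fin.tail w)) := rfl

/-- The cochain `(w, x) ↦ β x (f w)`, where `β` only depends on the component of `x` in `M`. -/
def snocMul {n : ℕ} (β : M →ₗ[k] Y →ₗ[k] Z) (f : Cochain k (TrivSqZeroExt A M) Y n) :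
    Cochain k (TrivSqZeroExt A M) Z (n + 1) :=
  MultilinearMap.uncurryRight (M := fun _ => TrivSqZeroExt A M)
    ((LinearMap.flip (β ∘ₗ sndₗ k A M)).compMultilinearMap f)

@[simp] theorem snocMul_apply {n : ℕ} (β : M →ₗ[k] Y →ₗ[k] Z)
    (f : Cochain k (TrivSqZeroExt A M) Y n) (w : Fin (n + 1) → TrivSqZeroExt A M) :
    snocMul β f w = β (w (Fin.last n)).snd (f (Fin.init w)) := rfl

theorem consMul_mem_weight {p n : ℕ} (β : M →ₗ[k] Y →ₗ[k] Z)
    {f : Cochain k (TrivSqZeroExt A M) Y n} (hf : f ∈ weight k A M Y p n) :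
    consMul β f ∈ weight k A M Z (p + 1) (n + 1) := by
  intro S x hS hx
  rw [consMul_apply]
  by_cases h : 0 ∈ S
  · rw [hf _ _ _ hx.tail, map_zero]
    rw [card_filter_succ_mem, if_pos h] at hS
    omega
  · rw [hx.2 _ h, map_zero, LinearMap.zero_apply]

theorem snocMul_mem_weight {p n : ℕ} (β : M →ₗ[k] Y →ₗ[k] Z)
    {f : Cochain k (TrivSqZeroExt A M) Y n} (hf : f ∈ weight k A M Y p n) :
    snocMul β f ∈ weight k A M Z (p + 1) (n + 1) := by
  intro S x hS hx
  rw [snocMul_apply]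
  by_cases h : Fin.last n ∈ S
  · rw [hf _ _ _ hx.init, map_zero]
    rw [card_filter_castSucc_mem, if_pos h] at hS
    omega
  · rw [hx.2 _ h, map_zero, LinearMap.zero_apply]

theorem firstSlice_inl_mem_weight {p n : ℕ} {f : Cochain k (TrivSqZeroExt A M) Y (n + 1)}
    (hf : f ∈ weight k A M Y p (n + 1)) :
    firstSlice (inlₗ k A M) f ∈ weight k A M (LeftCoind k A Y) p n :=
  fun S x hS hx => LeftCoind.ext fun a => curryLeft_inl_mem_weight hf a S x hS hx

theorem firstSlice_inr_mem_weight {p n : ℕ} {f : Cochain k (TrivSqZeroExt A M) Y (n + 1)}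
    (hf : f ∈ weight k A M Y (p + 1) (n + 1)) :
    firstSlice (inrₗ k A M) f ∈ weight k A M (LeftCoind k M Y) p n :=
  fun S x hS hx => LeftCoind.ext fun a => curryLeft_inr_mem_weight hf a S x hS hx

theorem lastSlice_inl_mem_weight {p n : ℕ} {f : Cochain k (TrivSqZeroExt A M) Y (n + 1)}
    (hf : f ∈ weight k A M Y p (n + 1)) :
    lastSlice (inlₗ k A M) f ∈ weight k A M (RightCoind k A Y) p n :=
  fun S x hS hx => RightCoind.ext fun a => curryLast_inl_mem_weight hf a S x hS hx

theorem lastSlice_inr_mem_weight {p n : ℕ} {f : Cochain k (TrivSqZeroExt A M) Y (n + 1)}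
    (hf : f ∈ weight k A M Y (p + 1) (n + 1)) :
    lastSlice (inrₗ k A M) f ∈ weight k A M (RightCoind k M Y) p n :=
  fun S x hS hx => RightCoind.ext fun a => curryLast_inr_mem_weight hf a S x hS hx

end Slices

end TrivSqZeroExt

/-! ### Acyclicity for coinduced coefficients. -/

namespace TrivSqZeroExt

open Hochschild

variable {k : Type v} [Field k] {A M : Type u} [Ring A] [Algebra k A] [AddCommGroup M] [Module k M]
  [Module A M] [Module Aᵐᵒᵖ M] [SMulCommClass A Aᵐᵒᵖ M] [IsScalarTower k A M]
  [IsScalarTower k Aᵐᵒᵖ M]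
variable {X X' : Type u} [AddCommGroup X] [Module k X] [Module A X] [Module Aᵐᵒᵖ X]
  [SMulCommClass A Aᵐᵒᵖ X] [IsScalarTower k A X] [IsScalarTower k Aᵐᵒᵖ X]
  [AddCommGroup X'] [Module k X'] [Module A X'] [Module Aᵐᵒᵖ X']
  [SMulCommClass A Aᵐᵒᵖ X'] [IsScalarTower k A X'] [IsScalarTower k Aᵐᵒᵖ X']

variable (k A M X) in
/-- The cocycles of weight `p` and degree larger than `p` are coboundaries. -/
def WeightAcyclic (p : ℕ) : Prop :=
  ∀ n, p ≤ n → ∀ f ∈ weight k A M X p (n + 1), d (n + 1) f = 0 →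
    ∃ g ∈ weight k A M X p n, d n g = f

theorem WeightAcyclic.of_retract {p : ℕ} (h : WeightAcyclic k A M X' p) (i : X →ₗ[k] X')
    (r : X' →ₗ[k] X) (hi : ∀ (a : A) x, i (a • x) = a • i x)
    (hi' : ∀ (a : A) x, i (op a • x) = op a • i x) (hr : ∀ (a : A) x, r (a • x) = a • r x)
    (hr' : ∀ (a : A) x, r (op a • x) = op a • r x) (hri : ∀ x, r (i x) = x) :
    WeightAcyclic k A M X p := by
  intro n hn f hf hdf
  obtain ⟨g, hg, hgf⟩ := h n hn (i.compMultilinearMap f) (comp_mem_weight i hf)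
    (by rw [← map_d i (fun b => hi b.fst) (fun b => hi' b.fst), hdf]; ext; simp)
  refine ⟨r.compMultilinearMap g, comp_mem_weight r hg, ?_⟩
  rw [← map_d r (fun b => hr b.fst) (fun b => hr' b.fst), hgf]
  ext w
  simp [hri]

section Left

variable {Y : Type u} [AddCommGroup Y] [Module k Y] [Module Aᵐᵒᵖ Y] [IsScalarTower k Aᵐᵒᵖ Y]

/-- An element `m` in first place acts by zero on the coefficients, and its product with the next
entry is `m a`. This is the left action on `LeftCoind k M Y`, so slicing off `m` turns cocycles into
cocycles of one weight and one degree less. -/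
theorem map_d_cons_inr {n : ℕ} (φ : X →ₗ[k] Y) (hφ : ∀ (a : A) x, φ (op a • x) = op a • φ x)
    (f : Cochain k (TrivSqZeroExt A M) X (n + 1)) (m : M) (w : Fin (n + 1) → TrivSqZeroExt A M) :
    φ (d (n + 1) f (Fin.cons (inr m) w : Fin (n + 2) → TrivSqZeroExt A M)) =
      -d n (firstSlice (inrₗ k A M) (φ.compMultilinearMap f)) w m := by
  have hm : inr m * w 0 = inr (op (w 0).fst • m) := by ext <;> simp
  rw [d_cons, d_eq_add_rightPart, smul_eq_fst_smul, fst_inr, zero_smul, zero_sub, map_sub, map_neg,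
    map_rightPart φ (fun b => hφ b.fst), LeftCoind.add_apply, ← LeftCoind.eval_apply m
    (rightPart _ _), map_rightPart (LeftCoind.eval m) (fun _ _ => rfl), hm, neg_add, sub_eq_add_neg]
  rfl

/-- With `w = (x, w₀, …)`, the left action of the `A`-part of `x` cancels its product with the
`M`-part of `w₀`. The surviving product of the `M`-part of `x` with the `A`-part of `w₀` is the left
action term of `d n h`. -/
theorem d_consMul_apply {n : ℕ} (h : Cochain k (TrivSqZeroExt A M) (LeftCoind k M Y) n)
    (β : M →ₗ[k] LeftCoind k M Y →ₗ[k] LeftCoind k A Y) (hβ : ∀ m g (a : A), β m g a = g (a • m))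
    (w : Fin (n + 2) → TrivSqZeroExt A M) (a : A) :
    d (n + 1) (consMul β h) w a = -d n h (Fin.tail w) (a • (w 0).snd) := by
  obtain ⟨x, w, rfl⟩ : ∃ x v, w = Fin.cons x v := ⟨w 0, Fin.tail w, (Fin.cons_self_tail w).symm⟩
  rw [d_cons, d_eq_add_rightPart, Fin.tail_cons, Fin.cons_zero, ← LeftCoind.eval_apply a, map_sub,
    map_rightPart (LeftCoind.eval a) (fun _ _ => rfl), LeftCoind.add_apply,
    ← LeftCoind.eval_apply _ (rightPart _ _), map_rightPart (LeftCoind.eval _) (fun _ _ => rfl),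
    neg_add, sub_eq_add_neg]
  congr 1
  · simp only [smul_eq_fst_smul, map_sub, LeftCoind.eval_apply, LeftCoind.smul_left_apply,
      consMul_apply, Fin.cons_zero, Fin.tail_cons, hβ, snd_mul, map_add, op_smul_eq_mul,
      mul_smul, LinearMap.add_apply]
    rw [smul_comm a (op (w 0).fst)]
    abel
  · congr 2
    ext v
    simp [hβ]

/-- The homotopy formula for `s f = (w ↦ (a ↦ f(a, w)(1)))`, resting on `(a g)(1) = g(a)`. The slice
by `A` misses the `M`-part of `a w₀`, and this is the error term at the end. -/
theorem d_cons_inl_apply_one {n : ℕ} (f : Cochain k (TrivSqZeroExt A M) (LeftCoind k A Y) (n + 1))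
    (a : A) (w : Fin (n + 1) → TrivSqZeroExt A M) :
    d (n + 1) f (Fin.cons (inl a) w : Fin (n + 2) → TrivSqZeroExt A M) 1 =
      f w a - d n (firstSlice (inlₗ k A M) ((LeftCoind.eval 1).compMultilinearMap f)) w a -
        f (Fin.cons (inr (a • (w 0).snd)) (Fin.tail w) : Fin (n + 1) → TrivSqZeroExt A M) 1 := by
  have ha : inl a * w 0 = inl (a * (w 0).fst) + inr (a • (w 0).snd) := by ext <;> simp
  rw [d_cons, d_eq_add_rightPart, ← LeftCoind.eval_apply 1, map_sub,
    map_rightPart (LeftCoind.eval 1) (fun _ _ => rfl), LeftCoind.add_apply,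
    ← LeftCoind.eval_apply a (rightPart _ _), map_rightPart (LeftCoind.eval a) (fun _ _ => rfl),
    ha, MultilinearMap.cons_add]
  simp only [smul_eq_fst_smul, fst_inl, map_sub, map_add, LeftCoind.eval_apply,
    LeftCoind.smul_left_apply, op_smul_eq_mul, one_mul, firstSlice_apply, inlₗ_apply,
    LinearMap.compMultilinearMap_apply]
  have : (LeftCoind.eval 1).compMultilinearMap (f.curryLeft (inl a)) =
    (LeftCoind.eval a).compMultilinearMap
      (firstSlice (inlₗ k A M) ((LeftCoind.eval 1).compMultilinearMap f)) := rfl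
  rw [this]
  abel

theorem weightAcyclic_leftCoind_zero : WeightAcyclic k A M (LeftCoind k A Y) 0 := by
  intro n _ f hf hdf
  refine ⟨_, firstSlice_inl_mem_weight (comp_mem_weight (LeftCoind.eval 1) hf), ?_⟩
  ext w a
  have h := d_cons_inl_apply_one f a w
  -- In weight `0` the error term of the homotopy has an entry in `M`, hence vanishes.
  have h₀ := congrArg (fun g => g (Fin.tail w) 1) (curryLeft_inr_eq_zero hf (a • (w 0).snd))
  rw [hdf] at h
  simp only [MultilinearMap.curryLeft_apply] at h₀
  rw [h₀] at h
  change 0 = _ - _ - 0 at h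
  rw [sub_zero] at h
  exact (sub_eq_zero.1 h.symm).symm

/-- The error term of the homotopy is built from the slice of `f` by `M`, a cocycle of weight `p`
with values in `LeftCoind k M Y`. A primitive `h` of it, transported by `consMul`, corrects the
homotopy. -/
theorem weightAcyclic_leftCoind_succ {p : ℕ} (hM : WeightAcyclic k A M (LeftCoind k M Y) p) :
    WeightAcyclic k A M (LeftCoind k A Y) (p + 1) := by
  intro n hn f hf hdf
  obtain ⟨n, rfl⟩ : ∃ m, n = m + 1 := ⟨n - 1, by omega⟩
  have hf₁ := comp_mem_weight (LeftCoind.eval 1) hf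
  obtain ⟨h, hh, hdh⟩ := hM n (by omega) _ (firstSlice_inr_mem_weight hf₁) (by
    ext w m
    have := map_d_cons_inr (LeftCoind.eval 1) (fun _ _ => rfl) f m w
    rw [hdf] at this
    change 0 = - _ at this
    rw [zero_eq_neg] at this
    exact this)
  -- Precomposition of `g` with `a ↦ a m`, the form in which the error term depends on the `M`-part
  -- of the first entry.
  let β : M →ₗ[k] LeftCoind k M Y →ₗ[k] LeftCoind k A Y :=
    LinearMap.mk₂ k (fun m g => (g : M →ₗ[k] Y) ∘ₗ
        (LinearMap.toSpanSingleton A M m).restrictScalars k)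
      (fun m m' g => LeftCoind.ext fun a => by
        exact (congrArg g (smul_add a m m')).trans (map_add g _ _))
      (fun c m g => LeftCoind.ext fun a => by
        exact (congrArg g (smul_comm a c m)).trans (map_smul g _ _))
      (fun _ _ _ => rfl) (fun _ _ _ => rfl)
  have hβ : ∀ m g (a : A), β m g a = g (a • m) := fun _ _ _ => rfl
  -- The coboundary of `consMul β h` is minus the error term, so subtracting it restores the missing
  -- part of `f`.
  refine ⟨firstSlice (inlₗ k A M) ((LeftCoind.eval 1).compMultilinearMap f) - consMul β h,
    Submodule.sub_mem _ (firstSlice_inl_mem_weight hf₁) (consMul_mem_weight β hh), ?_⟩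
  ext w a
  have h₁ := d_cons_inl_apply_one f a w
  have h₂ := d_consMul_apply h β hβ w a
  rw [hdf] at h₁
  rw [hdh] at h₂
  change 0 = _ at h₁
  rw [map_sub]
  rw [sub_apply, LeftCoind.sub_apply, h₂]
  rw [eq_comm, sub_sub, sub_eq_zero] at h₁
  rw [h₁, sub_neg_eq_add]
  rfl

end Left

section Right

variable {Y : Type u} [AddCommGroup Y] [Module k Y] [Module A Y] [IsScalarTower k A Y]

theorem map_d_snoc_inr {n : ℕ} (φ : X →ₗ[k] Y) (hφ : ∀ (a : A) x, φ (a • x) = a • φ x)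
    (f : Cochain k (TrivSqZeroExt A M) X (n + 1)) (m : M) (w : Fin (n + 1) → TrivSqZeroExt A M) :
    φ (d (n + 1) f (Fin.snoc w (inr m) : Fin (n + 2) → TrivSqZeroExt A M)) =
      d n (lastSlice (inrₗ k A M) (φ.compMultilinearMap f)) w m := by
  have hm : w (Fin.last n) * inr m = inr ((w (Fin.last n)).fst • m) := by ext <;> simp
  rw [d_snoc, d_eq_leftPart_add, op_smul_eq_fst_smul, fst_inr, op_zero, zero_smul, smul_zero,
    sub_zero, map_add, map_leftPart φ (fun b => hφ b.fst), RightCoind.add_apply,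
    ← RightCoind.eval_apply m (leftPart _ _),
    map_leftPart (RightCoind.eval m) (fun _ _ => rfl), hm, map_smul]
  rfl

theorem d_snocMul_apply {n : ℕ} (h : Cochain k (TrivSqZeroExt A M) (RightCoind k M Y) n)
    (β : M →ₗ[k] RightCoind k M Y →ₗ[k] RightCoind k A Y)
    (hβ : ∀ m g (a : A), β m g a = g (op a • m))
    (w : Fin (n + 2) → TrivSqZeroExt A M) (a : A) :
    d (n + 1) (snocMul β h) w a = d n h (Fin.init w) (op a • (w (Fin.last (n + 1))).snd) := by
  obtain ⟨w, x, rfl⟩ : ∃ v x, w = Fin.snoc v x :=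
    ⟨Fin.init w, w (Fin.last _), (Fin.snoc_init_self w).symm⟩
  rw [d_snoc, d_eq_leftPart_add, Fin.init_snoc, Fin.snoc_last, ← RightCoind.eval_apply a,
    add_sub_assoc, map_add,
    map_leftPart (RightCoind.eval a) (fun _ _ => rfl), RightCoind.add_apply,
    ← RightCoind.eval_apply _ (leftPart _ _),
    map_leftPart (RightCoind.eval _) (fun _ _ => rfl)]
  congr 1
  · congr 1
    ext v
    simp [hβ]
  · rw [← smul_sub, map_smul, RightCoind.smul_apply]
    congr 1
    simp only [op_smul_eq_fst_smul, map_sub, RightCoind.eval_apply, RightCoind.smul_right_apply,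
      snocMul_apply, Fin.snoc_last, Fin.init_snoc, hβ, snd_mul, map_add, smul_eq_mul, unop_op,
      op_mul, mul_smul, LinearMap.add_apply]
    rw [smul_comm _ (op a)]
    abel

theorem d_snoc_inl_apply_one {n : ℕ} (f : Cochain k (TrivSqZeroExt A M) (RightCoind k A Y) (n + 1))
    (a : A) (w : Fin (n + 1) → TrivSqZeroExt A M) :
    d (n + 1) f (Fin.snoc w (inl a) : Fin (n + 2) → TrivSqZeroExt A M) 1 =
      d n (lastSlice (inlₗ k A M) ((RightCoind.eval 1).compMultilinearMap f)) w a +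
        (-1 : k) ^ (n + 1) • (f (Fin.snoc (Fin.init w) (inr (op a • (w (Fin.last n)).snd)) :
          Fin (n + 1) → TrivSqZeroExt A M) 1 - f w a) := by
  have ha : w (Fin.last n) * inl a =
      inl ((w (Fin.last n)).fst * a) + inr (op a • (w (Fin.last n)).snd) := by ext <;> simp
  rw [d_snoc, d_eq_leftPart_add, ← RightCoind.eval_apply 1, map_sub, map_add,
    map_leftPart (RightCoind.eval 1) (fun _ _ => rfl), RightCoind.add_apply,
    ← RightCoind.eval_apply a (leftPart _ _), map_leftPart (RightCoind.eval a) (fun _ _ => rfl),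
    ha, MultilinearMap.snoc_add]
  simp only [op_smul_eq_fst_smul, fst_inl, map_smul, map_add, RightCoind.eval_apply,
    RightCoind.smul_right_apply, smul_eq_mul, mul_one, lastSlice_apply, inlₗ_apply,
    LinearMap.compMultilinearMap_apply, unop_op, RightCoind.smul_apply]
  have : (RightCoind.eval 1).compMultilinearMap (curryLast f (inl a)) =
    (RightCoind.eval a).compMultilinearMap
      (lastSlice (inlₗ k A M) ((RightCoind.eval 1).compMultilinearMap f)) := rfl
  rw [this, smul_sub, smul_add]
  abel

/-- The homotopy formula solved for `f`. The sign is that of the last two terms of the coboundary,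
and it is its own inverse. -/
theorem apply_eq_of_d_eq_zero {n : ℕ} {f : Cochain k (TrivSqZeroExt A M) (RightCoind k A Y) (n + 1)}
    (hf : d (n + 1) f = 0) (w : Fin (n + 1) → TrivSqZeroExt A M) (a : A) :
    f w a = (-1 : k) ^ (n + 1) •
        d n (lastSlice (inlₗ k A M) ((RightCoind.eval 1).compMultilinearMap f)) w a +
      f (Fin.snoc (Fin.init w) (inr (op a • (w (Fin.last n)).snd)) :
        Fin (n + 1) → TrivSqZeroExt A M) 1 := by
  have h := d_snoc_inl_apply_one f a w
  rw [hf] at h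
  change 0 = _ at h
  have h' := congrArg (fun y => (-1 : k) ^ (n + 1) • y) h
  simp only [smul_zero, smul_add, smul_smul, ← pow_add, ← two_mul, pow_mul, neg_one_sq, one_pow,
    one_smul] at h'
  rw [← sub_eq_zero, ← neg_eq_zero, h']
  abel

theorem weightAcyclic_rightCoind_zero : WeightAcyclic k A M (RightCoind k A Y) 0 := by
  intro n _ f hf hdf
  refine ⟨_, Submodule.smul_mem _ ((-1 : k) ^ (n + 1))
    (lastSlice_inl_mem_weight (comp_mem_weight (RightCoind.eval 1) hf)), ?_⟩
  ext w a
  have h₀ := congrArg (fun g => g (Fin.init w) 1)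
    (curryLast_inr_eq_zero hf (op a • (w (Fin.last n)).snd))
  simp only [curryLast_apply] at h₀
  rw [apply_eq_of_d_eq_zero hdf, h₀, map_smul]
  exact (add_zero _).symm

theorem weightAcyclic_rightCoind_succ {p : ℕ} (hM : WeightAcyclic k A M (RightCoind k M Y) p) :
    WeightAcyclic k A M (RightCoind k A Y) (p + 1) := by
  intro n hn f hf hdf
  obtain ⟨n, rfl⟩ : ∃ m, n = m + 1 := ⟨n - 1, by omega⟩
  have hf₁ := comp_mem_weight (RightCoind.eval 1) hf
  obtain ⟨h, hh, hdh⟩ := hM n (by omega) _ (lastSlice_inr_mem_weight hf₁) (by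
    ext w m
    rw [← map_d_snoc_inr (RightCoind.eval 1) (fun _ _ => rfl), hdf]
    rfl)
  let β : M →ₗ[k] RightCoind k M Y →ₗ[k] RightCoind k A Y :=
    LinearMap.mk₂ k (fun m g => (g : M →ₗ[k] Y) ∘ₗ
        (LinearMap.toSpanSingleton Aᵐᵒᵖ M m).restrictScalars k ∘ₗ (opLinearEquiv k).toLinearMap)
      (fun m m' g => RightCoind.ext fun a => by
        exact (congrArg g (smul_add (op a) m m')).trans (map_add g _ _))
      (fun c m g => RightCoind.ext fun a => by
        exact (congrArg g (smul_comm (op a) c m)).trans (map_smul g _ _))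
      (fun _ _ _ => rfl) (fun _ _ _ => rfl)
  have hβ : ∀ m g (a : A), β m g a = g (op a • m) := fun _ _ _ => rfl
  refine ⟨(-1 : k) ^ (n + 1 + 1) •
    lastSlice (inlₗ k A M) ((RightCoind.eval 1).compMultilinearMap f) + snocMul β h,
    Submodule.add_mem _ (Submodule.smul_mem _ _ (lastSlice_inl_mem_weight hf₁))
      (snocMul_mem_weight β hh), ?_⟩
  ext w a
  rw [map_add, map_smul, add_apply, RightCoind.add_apply,
    d_snocMul_apply h β hβ w a, hdh, apply_eq_of_d_eq_zero hdf]
  rfl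

end Right

section Projective

variable {Y : Type u} [AddCommGroup Y] [Module k Y]

/-- The maps `A → Y^M` over `k` extend to maps from the free module on `M`. -/
def sumExtend (v : M →₀ Aᵐᵒᵖ) : LeftCoind k A (M → Y) →ₗ[k] Y where
  toFun G := v.sum fun m c => G c.unop m
  map_add' G G' := by simp [Finsupp.sum_add]
  map_smul' c G := by simp [Finsupp.smul_sum]

theorem sumExtend_apply (v : M →₀ Aᵐᵒᵖ) (G : LeftCoind k A (M → Y)) :
    sumExtend v G = v.sum fun m c => G c.unop m := rfl

theorem sumExtend_add (v v' : M →₀ Aᵐᵒᵖ) (G : LeftCoind k A (M → Y)) :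
    sumExtend (v + v') G = sumExtend v G + sumExtend v' G := by
  simp only [sumExtend_apply]
  exact Finsupp.sum_add_index' (by simp) (by simp)

theorem sumExtend_smul (c : k) (v : M →₀ Aᵐᵒᵖ) (G : LeftCoind k A (M → Y)) :
    sumExtend (c • v) G = c • sumExtend v G := by
  rw [sumExtend_apply, Finsupp.sum_smul_index' (by simp), sumExtend_apply, Finsupp.smul_sum]
  simp

/-- The induction must range over all `Y`: weight `p + 1` for `Y` uses weight `p` for `M → Y`, since
`Hom_k(M, Y)` is a retract of `Hom_k(A, M → Y)`. -/
theorem weightAcyclic_leftCoind_of_projective [Module.Projective Aᵐᵒᵖ M] (p : ℕ) :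
    ∀ (Y : Type u) [AddCommGroup Y] [Module k Y] [Module Aᵐᵒᵖ Y] [IsScalarTower k Aᵐᵒᵖ Y],
      WeightAcyclic k A M (LeftCoind k A Y) p := by
  induction p with
  | zero => intro Y _ _ _ _; exact weightAcyclic_leftCoind_zero
  | succ p ih =>
    intro Y _ _ _ _
    -- A linear section of the canonical map from the free right module on the set `M`. In the
    -- retract below, the inclusion sends `g` to `a ↦ (m ↦ g(m a))` and the retraction restricts to
    -- `M` along `s`.
    obtain ⟨s, hs⟩ := Module.Projective.out (R := Aᵐᵒᵖ) (P := M)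
    have hsk : ∀ (c : k) m, s (c • m) = c • s m := (s.restrictScalars k).map_smul
    refine weightAcyclic_leftCoind_succ ((ih (M → Y)).of_retract
      { toFun := fun g => LinearMap.pi fun m =>
          (g : M →ₗ[k] Y) ∘ₗ (LinearMap.toSpanSingleton Aᵐᵒᵖ M m).restrictScalars k ∘ₗ
            (opLinearEquiv k).toLinearMap
        map_add' := fun _ _ => rfl
        map_smul' := fun _ _ => rfl }
      { toFun := fun G =>
          { toFun := fun m => sumExtend (s m) G
            map_add' := fun m m' => by rw [map_add, sumExtend_add]
            map_smul' := fun c m => by rw [hsk, sumExtend_smul]; rfl }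
        map_add' := fun G G' => LeftCoind.ext fun m => map_add (sumExtend (s m)) G G'
        map_smul' := fun c G => LeftCoind.ext fun m => map_smul (sumExtend (s m)) c G }
      ?_ ?_ ?_ ?_ ?_)
    · intro a g
      ext b m
      exact congrArg g (mul_smul (op a) (op b) m).symm
    · intro a g
      rfl
    · intro a G
      refine LeftCoind.ext fun m => ?_
      change sumExtend (s m) (a • G) = sumExtend (s (op a • m)) G
      rw [s.map_smul, sumExtend_apply, sumExtend_apply, Finsupp.sum_smul_index' (by simp)]
      rfl
    · intro a G
      refine LeftCoind.ext fun m => ?_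
      change sumExtend (s m) (op a • G) = op a • sumExtend (s m) G
      rw [sumExtend_apply, sumExtend_apply, Finsupp.smul_sum]
      rfl
    · intro g
      refine LeftCoind.ext fun m => ?_
      -- Applying `g` to the expression of `m` as a combination with coefficients `s m` gives back
      -- `g m`.
      change (s m).sum (fun i c => g (c • i)) = g m
      conv_rhs => rw [← hs m, Finsupp.linearCombination_apply, map_finsuppSum]
      rfl

/-- The maps `A → Y^M` over `k` extend to maps from the free module on `M`. -/
def sumExtendRight (v : M →₀ A) : RightCoind k A (M → Y) →ₗ[k] Y where
  toFun G := v.sum fun m c => G c m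
  map_add' G G' := by simp [Finsupp.sum_add]
  map_smul' c G := by simp [Finsupp.smul_sum]

theorem sumExtendRight_apply (v : M →₀ A) (G : RightCoind k A (M → Y)) :
    sumExtendRight v G = v.sum fun m c => G c m := rfl

theorem sumExtendRight_add (v v' : M →₀ A) (G : RightCoind k A (M → Y)) :
    sumExtendRight (v + v') G = sumExtendRight v G + sumExtendRight v' G := by
  simp only [sumExtendRight_apply]
  exact Finsupp.sum_add_index' (by simp) (by simp)

theorem sumExtendRight_smul (c : k) (v : M →₀ A) (G : RightCoind k A (M → Y)) :
    sumExtendRight (c • v) G = c • sumExtendRight v G := by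
  rw [sumExtendRight_apply, Finsupp.sum_smul_index' (by simp), sumExtendRight_apply,
    Finsupp.smul_sum]
  simp

theorem weightAcyclic_rightCoind_of_projective [Module.Projective A M] (p : ℕ) :
    ∀ (Y : Type u) [AddCommGroup Y] [Module k Y] [Module A Y] [IsScalarTower k A Y],
      WeightAcyclic k A M (RightCoind k A Y) p := by
  induction p with
  | zero => intro Y _ _ _ _; exact weightAcyclic_rightCoind_zero
  | succ p ih =>
    intro Y _ _ _ _
    obtain ⟨s, hs⟩ := Module.Projective.out (R := A) (P := M)
    have hsk : ∀ (c : k) m, s (c • m) = c • s m := (s.restrictScalars k).map_smul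
    refine weightAcyclic_rightCoind_succ ((ih (M → Y)).of_retract
      { toFun := fun g => LinearMap.pi fun m =>
          (g : M →ₗ[k] Y) ∘ₗ (LinearMap.toSpanSingleton A M m).restrictScalars k
        map_add' := fun _ _ => rfl
        map_smul' := fun _ _ => rfl }
      { toFun := fun G =>
          { toFun := fun m => sumExtendRight (s m) G
            map_add' := fun m m' => by rw [map_add, sumExtendRight_add]
            map_smul' := fun c m => by rw [hsk, sumExtendRight_smul]; rfl }
        map_add' := fun G G' => RightCoind.ext fun m => map_add (sumExtendRight (s m)) G G'
        map_smul' := fun c G => RightCoind.ext fun m => map_smul (sumExtendRight (s m)) c G }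
      ?_ ?_ ?_ ?_ ?_)
    · intro a g
      rfl
    · intro a g
      ext b m
      exact congrArg g (mul_smul a b m).symm
    · intro a G
      refine RightCoind.ext fun m => ?_
      change sumExtendRight (s m) (a • G) = a • sumExtendRight (s m) G
      rw [sumExtendRight_apply, sumExtendRight_apply, Finsupp.smul_sum]
      rfl
    · intro a G
      refine RightCoind.ext fun m => ?_
      change sumExtendRight (s m) (op a • G) = sumExtendRight (s (a • m)) G
      rw [s.map_smul, sumExtendRight_apply, sumExtendRight_apply, Finsupp.sum_smul_index' (by simp)]
      rfl
    · intro g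
      refine RightCoind.ext fun m => ?_
      change (s m).sum (fun i c => g (c • i)) = g m
      conv_rhs => rw [← hs m, Finsupp.linearCombination_apply, map_finsuppSum]
      rfl

end Projective

end TrivSqZeroExt

/-! ### Universal property of the balanced tensor product. -/

namespace AlgBimodule

variable {k : Type v} [Field k] {A : Type u} [Ring A] [Algebra k A]

section TensorHom

variable {M N X : Type u}
  [AddCommGroup M] [Module k M] [Module A M] [Module Aᵐᵒᵖ M] [SMulCommClass A Aᵐᵒᵖ M]
  [IsScalarTower k A M] [IsScalarTower k Aᵐᵒᵖ M]
  [AddCommGroup N] [Module k N] [Module A N] [Module Aᵐᵒᵖ N] [SMulCommClass A Aᵐᵒᵖ N]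
  [IsScalarTower k A N] [IsScalarTower k Aᵐᵒᵖ N] [AddCommGroup X] [Module k X]

variable (k A M N) in
/-- The bilinear map `(m, n) ↦ m ⊗ n`. -/
def tmulₗ : M →ₗ[k] N →ₗ[k] BalancedTensor k A M N :=
  LinearMap.mk₂ k (tmul k A M N) (tmul_add_left k A M N) (tmul_smul_left k A M N)
    (tmul_add_right k A M N) (fun c m n => tmul_smul_right k A M N c m n)

@[simp] theorem tmulₗ_apply (m : M) (n : N) : tmulₗ k A M N m n = tmul k A M N m n := rfl

theorem tmul_op_smul (m : M) (a : A) (n : N) :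
    tmul k A M N (op a • m) n = tmul k A M N m (a • n) :=
  (Submodule.Quotient.eq _).2 (Submodule.subset_span ⟨m, a, n, rfl⟩)

@[simp] theorem smul_tmul (a : A) (m : M) (n : N) :
    a • tmul k A M N m n = tmul k A M N (a • m) n := rfl

@[simp] theorem op_smul_tmul (a : Aᵐᵒᵖ) (m : M) (n : N) :
    a • tmul k A M N m n = tmul k A M N m (a • n) := rfl

theorem hom_ext {f g : BalancedTensor k A M N →ₗ[k] X}
    (h : ∀ m n, f (tmul k A M N m n) = g (tmul k A M N m n)) : f = g :=
  Submodule.linearMap_qext _ (TensorProduct.ext' h)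

/-- The map `n ↦ (m ↦ φ (m ⊗ n))`. -/
def curry (φ : BalancedTensor k A M N →ₗ[k] X) : N →ₗ[k] LeftCoind k M X :=
  ((tmulₗ k A M N).compr₂ φ).flip

/-- As `A` acts on the left of `LeftCoind k M X` through the right action on `M`, left linearity of
`ψ` is exactly the balancing relation. -/
theorem exists_uncurry [Module Aᵐᵒᵖ X] [IsScalarTower k Aᵐᵒᵖ X] (ψ : N →ₗ[k] LeftCoind k M X)
    (hψ : ∀ (a : A) n, ψ (a • n) = a • ψ n) :
    ∃ φ : BalancedTensor k A M N →ₗ[k] X, ∀ m n, φ (tmul k A M N m n) = ψ n m := by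
  let ψ' : M →ₗ[k] N →ₗ[k] X := LinearMap.flip (ψ : N →ₗ[k] (M →ₗ[k] X))
  refine ⟨Submodule.liftQ (balancedRel k A M N) (TensorProduct.lift ψ') ?_, fun m n => ?_⟩
  · refine Submodule.span_le.2 ?_
    rintro _ ⟨m, a, n, rfl⟩
    have h := congrArg (fun g => g m) (hψ a n)
    simp only [SetLike.mem_coe, LinearMap.mem_ker, map_sub, TensorProduct.lift.tmul]
    exact sub_eq_zero.2 h.symm
  · exact (Submodule.liftQ_apply _ _ _).trans (TensorProduct.lift.tmul _ _)

end TensorHom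

end AlgBimodule

/-! ### The universal cocycle and bimodule maps out of tensor powers. -/

namespace TrivSqZeroExt

open Hochschild AlgBimodule

variable (k : Type v) [Field k] (A M : Type u) [Ring A] [Algebra k A] [AddCommGroup M] [Module k M]
  [Module A M] [Module Aᵐᵒᵖ M] [SMulCommClass A Aᵐᵒᵖ M] [IsScalarTower k A M]
  [IsScalarTower k Aᵐᵒᵖ M]

/-- The universal cocycle `(m₁, …, m_p) ↦ m₁ ⊗ ⋯ ⊗ m_p`, extended by zero. -/
def tensorCocycle : ∀ p : ℕ, Cochain k (TrivSqZeroExt A M)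
    (tensorPower (⟨M⟩ : AlgBimodule k A) p).carrier p
  | 0 => MultilinearMap.constOfIsEmpty k _ (1 : A)
  | p + 1 => consMul (tmulₗ k A M _) (tensorCocycle p)

theorem tensorCocycle_mem_weight (p : ℕ) :
    tensorCocycle k A M p ∈ weight k A M _ p p := by
  induction p with
  | zero => exact fun S x hS _ => absurd (by simp [Finset.eq_empty_of_isEmpty S]) hS
  | succ p ih => exact consMul_mem_weight _ ih

/-- Of the two parts of the first product, `a m ⊗ n` cancels against the left action, while `m a ⊗ n
= m ⊗ a n` supplies the left action term of `d n f`. -/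
theorem d_consMul_tmul {N : Type u} [AddCommGroup N] [Module k N] [Module A N] [Module Aᵐᵒᵖ N]
    [SMulCommClass A Aᵐᵒᵖ N] [IsScalarTower k A N] [IsScalarTower k Aᵐᵒᵖ N] {n : ℕ}
    (f : Cochain k (TrivSqZeroExt A M) N n) :
    d (n + 1) (consMul (tmulₗ k A M N) f) = -consMul (tmulₗ k A M N) (d n f) := by
  ext w
  obtain ⟨x, w, rfl⟩ : ∃ x v, w = Fin.cons x v := ⟨w 0, Fin.tail w, (Fin.cons_self_tail w).symm⟩
  have hx : (consMul (tmulₗ k A M N) f).curryLeft x =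
      (tmulₗ k A M N x.snd).compMultilinearMap f := by
    ext v; simp
  rw [d_cons, neg_apply, consMul_apply _ (d n f), Fin.cons_zero, Fin.tail_cons, d_eq_add_rightPart, map_add,
    map_rightPart _ (fun b n => by rfl), hx, neg_add, ← sub_eq_add_neg]
  congr 1
  simp only [consMul_apply, Fin.cons_zero, Fin.tail_cons, snd_mul, tmulₗ_apply, smul_eq_fst_smul,
    smul_tmul, tmul_add_left, tmul_op_smul]
  abel

theorem d_tensorCocycle (p : ℕ) : d p (tensorCocycle k A M p) = 0 := by
  induction p with
  | zero =>
    ext w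
    have h : tensorCocycle k A M 0 = MultilinearMap.constOfIsEmpty k _ (1 : A) := rfl
    have hA : ∀ b : A, b • (1 : A) - op b • (1 : A) = 0 := fun b => by simp
    rw [d_apply, h]
    simp only [Finset.univ_eq_empty, Finset.sum_empty, add_zero, zero_add, pow_one, neg_smul,
      one_smul, ← sub_eq_add_neg]
    exact hA (w 0).fst
  | succ p ih =>
    have h := d_consMul_tmul k A M (tensorCocycle k A M p)
    rw [ih] at h
    refine h.trans ?_
    ext w
    exact neg_eq_zero.2 (map_zero (tmulₗ k A M _ (w 0).snd))

variable {k A M}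

/-- The values of the universal cocycle generate the tensor power. Currying the first factor
replaces `X` by `LeftCoind k M X`, so the induction quantifies over the target. -/
theorem tensorPower_hom_ext (p : ℕ) : ∀ {X : Type u} [AddCommGroup X] [Module k X] [Module A X]
    [Module Aᵐᵒᵖ X] {φ ψ : (tensorPower (⟨M⟩ : AlgBimodule k A) p).carrier →ₗ[k] X}
    (_ : ∀ (a : A) t, φ (a • t) = a • φ t) (_ : ∀ (a : A) t, ψ (a • t) = a • ψ t)
    (_ : ∀ w, φ (tensorCocycle k A M p w) = ψ (tensorCocycle k A M p w))
    (_ : ∀ (a : A) t, φ (op a • t) = op a • φ t) (_ : ∀ (a : A) t, ψ (op a • t) = op a • ψ t)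
    (_ : IsScalarTower k Aᵐᵒᵖ X),
    φ = ψ := by
  induction p with
  | zero =>
    intro X _ _ _ _ φ ψ hφ hψ h _ _ _
    refine LinearMap.ext fun (a : A) => ?_
    have h₁ : φ (1 : A) = ψ (1 : A) := h default
    have h₂ := (hφ a (1 : A)).trans ((congrArg (a • ·) h₁).trans (hψ a (1 : A)).symm)
    have h₃ : a • (1 : A) = a := mul_one a
    exact (congrArg φ h₃).symm.trans (h₂.trans (congrArg ψ h₃))
  | succ p ih =>
    intro X _ _ _ _ φ ψ hφ hψ h hφ' hψ' _
    have key : curry (N := (tensorPower (⟨M⟩ : AlgBimodule k A) p).carrier) φ = curry ψ := by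
      refine ih ?_ ?_ ?_ ?_ ?_ inferInstance
      · exact fun a t => LeftCoind.ext fun m => congrArg φ (tmul_op_smul m a t).symm
      · exact fun a t => LeftCoind.ext fun m => congrArg ψ (tmul_op_smul m a t).symm
      · exact fun w => LeftCoind.ext fun m => h (Fin.cons (inr m) w)
      · exact fun a t => LeftCoind.ext fun m => hφ' a (tmul k A M _ m t)
      · exact fun a t => LeftCoind.ext fun m => hψ' a (tmul k A M _ m t)
    exact hom_ext fun m t => congrArg (fun g => g t m) key

/-- The slice of `f` by `M` is a cocycle of weight and degree `p` with values in `LeftCoind k M X`.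
By induction it comes from a bimodule map `ψ`, which uncurries to the required `φ`; only left
linearity of `φ` needs the cocycle condition once more. -/
theorem exists_tensorPower_hom (p : ℕ) : ∀ {X : Type u} [AddCommGroup X] [Module k X] [Module A X]
    [Module Aᵐᵒᵖ X] [SMulCommClass A Aᵐᵒᵖ X] [IsScalarTower k A X] [IsScalarTower k Aᵐᵒᵖ X]
    (f : Cochain k (TrivSqZeroExt A M) X p) (_ : f ∈ weight k A M X p p) (_ : d p f = 0),
    ∃ φ : (tensorPower (⟨M⟩ : AlgBimodule k A) p).carrier →ₗ[k] X,
      (∀ (a : A) t, φ (a • t) = a • φ t) ∧ (∀ (a : A) t, φ (op a • t) = op a • φ t) ∧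
      φ.compMultilinearMap (tensorCocycle k A M p) = f := by
  induction p with
  | zero =>
    intro X _ _ _ _ _ _ _ f hf hdf
    have e : ∀ w, f w = f default := fun w => congrArg f (Subsingleton.elim _ _)
    have h : ∀ a : A, op a • f default = a • f default := fun a => by
      have := congrArg (fun g => g (fun _ => inl a)) hdf
      simp only [d_apply, Finset.univ_eq_empty, Finset.sum_empty, add_zero, zero_add, pow_one,
        neg_smul, one_smul, ← sub_eq_add_neg] at this
      exact ((congrArg (op a • ·) (e (Fin.init fun _ => inl a))).symm.trans
        (sub_eq_zero.1 this).symm).trans (congrArg (a • ·) (e (Fin.tail fun _ => inl a)))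
    refine ⟨(LinearMap.toSpanSingleton A X (f default)).restrictScalars k, ?_, ?_, ?_⟩
    · exact fun a (b : A) => mul_smul a b _
    · intro a (b : A)
      have h₁ : op a • f default = a • f default := h a
      change (b * a) • f default = op a • b • f default
      rw [← smul_comm, h₁, mul_smul]
    · ext w
      change (1 : A) • f default = f w
      rw [one_smul, Subsingleton.elim w default]
  | succ p ih =>
    intro X _ _ _ _ _ _ _ f hf hdf
    obtain ⟨ψ, hψ, hψ', hψf⟩ := ih (firstSlice (inrₗ k A M) f) (firstSlice_inr_mem_weight hf) (by
      ext w m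
      have h := map_d_cons_inr LinearMap.id (fun _ _ => rfl) f m w
      rw [hdf] at h
      exact neg_eq_zero.1 h.symm)
    have hψf' : ∀ w m, ψ (tensorCocycle k A M p w) m = f (Fin.cons (inr m) w) := fun w m =>
      congrArg (fun g => g w m) hψf
    -- With one entry in `A`, only `p` places remain for `p + 1` entries in `M`.
    have hinl : ∀ (a : A) w, f (Fin.cons (inl a) w) = 0 := fun a w =>
      congrArg (fun g => g w)
        (eq_zero_of_mem_weight (Nat.lt_succ_self p) (curryLeft_inl_mem_weight hf a))
    -- In `df(a, m, w) = 0` all terms still having `a` alone in first place vanish, which leaves `a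
    -- f(m, w) - f(a m, w)`.
    have hlin : ∀ (a : A) (m : M) w, f (Fin.cons (inr (a • m)) w) = a • f (Fin.cons (inr m) w) := by
      intro a m w
      have h := d_cons f (inl a) (Fin.cons (inr m) w)
      have hr : rightPart (f.curryLeft (inl a))
          (Fin.cons (inr m) w : Fin (p + 1) → TrivSqZeroExt A M) = 0 := by
        rw [eq_zero_of_mem_weight (Nat.lt_succ_self p) (curryLeft_inl_mem_weight hf a)]
        simp [rightPart]
      rw [hdf, hr, sub_zero, Fin.cons_zero, Fin.tail_cons, inl_mul_inr] at h
      exact (sub_eq_zero.1 h.symm).symm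
    obtain ⟨φ, hφ⟩ := exists_uncurry ψ hψ
    refine ⟨φ, fun a t => ?_, fun a t => ?_, ?_⟩
    · let L : LeftCoind k M X →ₗ[k] LeftCoind k M X :=
        { toFun := fun g => (g : M →ₗ[k] X) ∘ₗ Algebra.lsmul k k M a
          map_add' := fun _ _ => rfl
          map_smul' := fun _ _ => rfl }
      let R : LeftCoind k M X →ₗ[k] LeftCoind k M X :=
        { toFun := fun g => Algebra.lsmul k k X a ∘ₗ (g : M →ₗ[k] X)
          map_add' := fun g h => LeftCoind.ext fun m => smul_add a (g m) (h m)
          map_smul' := fun c g => LeftCoind.ext fun m => smul_comm a c (g m) }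
      -- Left linearity in `m` is known on values of the universal cocycle, and the uniqueness lemma
      -- extends it to the whole tensor power.
      have hLR : L ∘ₗ ψ = R ∘ₗ ψ := by
        refine tensorPower_hom_ext p ?_ ?_ ?_ ?_ ?_ inferInstance
        · intro b t
          refine LeftCoind.ext fun m => ?_
          change ψ (b • t) (a • m) = ψ t (a • op b • m)
          rw [hψ, smul_comm]
          rfl
        · intro b t
          refine LeftCoind.ext fun m => ?_
          change a • ψ (b • t) m = a • ψ t (op b • m)
          rw [hψ]
          rfl
        · intro w
          refine LeftCoind.ext fun m => ?_
          change ψ _ (a • m) = a • ψ _ m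
          rw [hψf', hψf', hlin]
        · intro b t
          refine LeftCoind.ext fun m => ?_
          change ψ (op b • t) (a • m) = op b • ψ t (a • m)
          rw [hψ']
          rfl
        · intro b t
          refine LeftCoind.ext fun m => ?_
          change a • ψ (op b • t) m = op b • a • ψ t m
          rw [hψ', ← smul_comm]
          rfl
      have := hom_ext (f := φ ∘ₗ (leftMul k A M _ a)) (g := Algebra.lsmul k k X a ∘ₗ φ)
        fun m t => by
          change φ (tmul k A M _ (a • m) t) = a • φ (tmul k A M _ m t)
          rw [hφ, hφ]
          exact congrArg (fun g => g t m) hLR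
      exact congrArg (fun g => g t) this
    · have := hom_ext (f := φ ∘ₗ (rightMul k A M _ (op a))) (g := Algebra.lsmul k k X (op a) ∘ₗ φ)
        fun m t => by
          change φ (tmul k A M _ m (op a • t)) = op a • φ (tmul k A M _ m t)
          rw [hφ, hφ, hψ']
          rfl
      exact congrArg (fun g => g t) this
    · ext w
      obtain ⟨x, w, rfl⟩ : ∃ x v, w = Fin.cons x v :=
        ⟨w 0, Fin.tail w, (Fin.cons_self_tail w).symm⟩
      change φ (tmul k A M _ x.snd (tensorCocycle k A M p w)) = _
      rw [hφ, hψf']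
      conv_rhs => rw [← inl_fst_add_inr_snd_eq x, MultilinearMap.cons_add, hinl, zero_add]

end TrivSqZeroExt

/-! ### Bimodules and modules over the enveloping algebra. -/

namespace AlgBimodule

variable {k : Type v} [Field k] {A : Type u} [Ring A] [Algebra k A]

/-- A module over the enveloping algebra as a bimodule. -/
def ofModuleCat (N : ModuleCat.{u} (A ⊗[k] Aᵐᵒᵖ)) : AlgBimodule k A :=
  letI : Module k N := Module.compHom N (algebraMap k (A ⊗[k] Aᵐᵒᵖ))
  letI : Module A N := Module.compHom N
    (Algebra.TensorProduct.includeLeft : A →ₐ[k] A ⊗[k] Aᵐᵒᵖ).toRingHom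
  letI : Module Aᵐᵒᵖ N := Module.compHom N
    (Algebra.TensorProduct.includeRight : Aᵐᵒᵖ →ₐ[k] A ⊗[k] Aᵐᵒᵖ).toRingHom
  haveI : SMulCommClass A Aᵐᵒᵖ N := ⟨fun a b x => by
    change (a ⊗ₜ[k] (1 : Aᵐᵒᵖ)) • ((1 : A) ⊗ₜ[k] b) • x =
      ((1 : A) ⊗ₜ[k] b) • (a ⊗ₜ[k] (1 : Aᵐᵒᵖ)) • x
    simp [← mul_smul]⟩
  haveI : IsScalarTower k A N := ⟨fun c a x => by
    change ((c • a) ⊗ₜ[k] (1 : Aᵐᵒᵖ)) • x =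
      algebraMap k (A ⊗[k] Aᵐᵒᵖ) c • (a ⊗ₜ[k] (1 : Aᵐᵒᵖ)) • x
    rw [← mul_smul, ← Algebra.smul_def, TensorProduct.smul_tmul']⟩
  haveI : IsScalarTower k Aᵐᵒᵖ N := ⟨fun c a x => by
    change ((1 : A) ⊗ₜ[k] (c • a)) • x =
      algebraMap k (A ⊗[k] Aᵐᵒᵖ) c • ((1 : A) ⊗ₜ[k] a) • x
    rw [← mul_smul, ← Algebra.smul_def, TensorProduct.tmul_smul]⟩
  ⟨N⟩

section Hom

variable {N N' : ModuleCat.{u} (A ⊗[k] Aᵐᵒᵖ)}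

/-- An additive map compatible with both actions is linear over the enveloping algebra. -/
def homMk (φ : N →+ N') (h : ∀ (a : A) x, φ ((a ⊗ₜ[k] (1 : Aᵐᵒᵖ)) • x) =
    (a ⊗ₜ[k] (1 : Aᵐᵒᵖ)) • φ x) (h' : ∀ (a : Aᵐᵒᵖ) x, φ (((1 : A) ⊗ₜ[k] a) • x) =
    ((1 : A) ⊗ₜ[k] a) • φ x) : N ⟶ N' :=
  ModuleCat.ofHom
    { φ with
      map_smul' := fun t x => by
        change φ (t • x) = t • φ x
        induction t with
        | zero =>
          exact (congrArg φ (zero_smul (A ⊗[k] Aᵐᵒᵖ) x)).trans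
            ((map_zero φ).trans (zero_smul (A ⊗[k] Aᵐᵒᵖ) (φ x)).symm)
        | add s t hs ht => rw [add_smul, map_add, hs, ht, add_smul]
        | tmul a b =>
          have : a ⊗ₜ[k] b = (a ⊗ₜ[k] (1 : Aᵐᵒᵖ)) * ((1 : A) ⊗ₜ[k] b) := by simp
          rw [this, mul_smul, h, h', mul_smul] }

/-- The `k`-linear map underlying a homomorphism. -/
def homMap (f : N ⟶ N') : (ofModuleCat N).carrier →ₗ[k] (ofModuleCat N').carrier where
  toFun := f.hom
  map_add' := f.hom.map_add
  map_smul' c x := f.hom.map_smul (algebraMap k _ c) x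

theorem homMap_smul (f : N ⟶ N') (a : A) (x : (ofModuleCat N).carrier) :
    homMap f (a • x) = a • homMap f x := f.hom.map_smul (a ⊗ₜ[k] (1 : Aᵐᵒᵖ)) x

theorem homMap_op_smul (f : N ⟶ N') (a : A) (x : (ofModuleCat N).carrier) :
    homMap f (op a • x) = op a • homMap f x := f.hom.map_smul ((1 : A) ⊗ₜ[k] op a) x

end Hom

section ToModuleCat

variable (P : AlgBimodule k A)

theorem toModuleCat_left_smul (a : A) (x : P.carrier) :
    ((a ⊗ₜ[k] (1 : Aᵐᵒᵖ)) • (show P.toModuleCat from x) : P.toModuleCat) = a • x := by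
  refine (TensorProduct.Algebra.smul_def (R := k) (M := P.carrier) a (1 : Aᵐᵒᵖ) x).trans ?_
  rw [one_smul]

theorem toModuleCat_right_smul (a : Aᵐᵒᵖ) (x : P.carrier) :
    (((1 : A) ⊗ₜ[k] a) • (show P.toModuleCat from x) : P.toModuleCat) = a • x := by
  refine (TensorProduct.Algebra.smul_def (R := k) (M := P.carrier) (1 : A) a x).trans ?_
  rw [one_smul]

/-- The identity as a linear map from a bimodule to the bimodule obtained from its module over the
enveloping algebra. -/
def unitEquiv : P.carrier ≃ₗ[k] (ofModuleCat P.toModuleCat).carrier where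
  toFun x := x
  invFun x := x
  map_add' _ _ := rfl
  map_smul' c x := by
    have h : (algebraMap k (A ⊗[k] Aᵐᵒᵖ) c) = (c • (1 : A)) ⊗ₜ[k] (1 : Aᵐᵒᵖ) := by
      rw [Algebra.algebraMap_eq_smul_one, Algebra.TensorProduct.one_def, TensorProduct.smul_tmul']
    refine Eq.trans ?_ (congrArg (fun t => t • (show P.toModuleCat from x)) h).symm
    rw [toModuleCat_left_smul, smul_assoc, one_smul]
  left_inv _ := rfl
  right_inv _ := rfl

theorem unitEquiv_smul (a : A) (x : P.carrier) : P.unitEquiv (a • x) = a • P.unitEquiv x :=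
  (toModuleCat_left_smul P a x).symm

theorem unitEquiv_op_smul (a : Aᵐᵒᵖ) (x : P.carrier) :
    P.unitEquiv (a • x) = a • P.unitEquiv x :=
  (toModuleCat_right_smul P a x).symm

end ToModuleCat

end AlgBimodule

/-! ### The weight complex as a functor of the coefficients. -/

namespace TrivSqZeroExt

open Hochschild AlgBimodule

section Complex

variable (k : Type v) [Field k] (A M : Type u) [Ring A] [Algebra k A] [AddCommGroup M] [Module k M]
  [Module A M] [Module Aᵐᵒᵖ M] [SMulCommClass A Aᵐᵒᵖ M] [IsScalarTower k A M]
  [IsScalarTower k Aᵐᵒᵖ M]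

/-- The differential on the cochains of weight `p`. -/
def weightD (X : Type u) [AddCommGroup X] [Module k X] [Module A X] [Module Aᵐᵒᵖ X]
    [SMulCommClass A Aᵐᵒᵖ X] [IsScalarTower k A X] [IsScalarTower k Aᵐᵒᵖ X] (p n : ℕ) :
    weight k A M X p n →ₗ[k] weight k A M X p (n + 1) :=
  (d n).restrict fun _ hf => d_mem_weight hf

/-- The part of weight `p` of the Hochschild complex of the trivial extension. -/
def weightComplex (X : Type u) [AddCommGroup X] [Module k X] [Module A X] [Module Aᵐᵒᵖ X]
    [SMulCommClass A Aᵐᵒᵖ X] [IsScalarTower k A X] [IsScalarTower k Aᵐᵒᵖ X] (p : ℕ) :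
    CochainComplex (ModuleCat.{u} k) ℕ :=
  CochainComplex.of (fun q => ModuleCat.of k (weight k A M X p (p + q)))
    (fun q => ModuleCat.ofHom (weightD k A M X p (p + q)))
    (fun q => by
      rw [← ModuleCat.ofHom_comp]
      congr 1
      exact LinearMap.ext fun f => Subtype.ext (d_d f.1))

theorem weightComplex_d (X : Type u) [AddCommGroup X] [Module k X] [Module A X] [Module Aᵐᵒᵖ X]
    [SMulCommClass A Aᵐᵒᵖ X] [IsScalarTower k A X] [IsScalarTower k Aᵐᵒᵖ X] (p q : ℕ) :
    (weightComplex k A M X p).d q (q + 1) = ModuleCat.ofHom (weightD k A M X p (p + q)) :=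
  CochainComplex.of_d (fun q => ModuleCat.of k (weight k A M X p (p + q)))
    (fun q => ModuleCat.ofHom (weightD k A M X p (p + q))) q

/-- Composition of cochains with a linear map. -/
def weightMap {X X' : Type u} [AddCommGroup X] [Module k X] [AddCommGroup X'] [Module k X']
    (φ : X →ₗ[k] X') (p n : ℕ) : weight k A M X p n →ₗ[k] weight k A M X' p n where
  toFun f := ⟨φ.compMultilinearMap f.1, comp_mem_weight φ f.2⟩
  map_add' f g := by ext; simp
  map_smul' c f := by ext; simp

/-- The weight complex as a functor on modules over the enveloping algebra. -/
def weightFunctor (p : ℕ) : ModuleCat.{u} (A ⊗[k] Aᵐᵒᵖ) ⥤ CochainComplex (ModuleCat.{u} k) ℕ where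
  obj N := weightComplex k A M (ofModuleCat N).carrier p
  map f := CochainComplex.ofHom
    (fun q => ModuleCat.ofHom (weightMap k A M (homMap f) p (p + q)))
    (fun q => by
      rw [weightComplex_d, weightComplex_d]
      change ModuleCat.ofHom _ ≫ ModuleCat.ofHom _ = ModuleCat.ofHom _ ≫ ModuleCat.ofHom _
      rw [← ModuleCat.ofHom_comp, ← ModuleCat.ofHom_comp]
      congr 1
      exact LinearMap.ext fun g => Subtype.ext (map_d (homMap f) (fun b => homMap_smul f b.fst)
        (fun b => homMap_op_smul f b.fst) g.1).symm)
  map_id N := by ext; rfl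
  map_comp f g := by ext; rfl

end Complex

end TrivSqZeroExt

/-! ### Recognising `Ext(T, -)` by dimension shifting. -/

namespace CategoryTheory.Abelian.Ext

open Limits

variable {k : Type v} [Ring k] {C : Type*} [Category.{u} C] [Abelian C] [Linear k C]
  [HasExt.{u} C]

variable (k) in
/-- Composition with the class of a short exact sequence, as a linear map. -/
def compExtClass (T : C) {S : ShortComplex C}
    (hS : S.ShortExact) (q : ℕ) : Ext T S.X₃ q →ₗ[k] Ext T S.X₁ (q + 1) where
  toFun x := x.comp hS.extClass rfl
  map_add' _ _ := add_comp _ _ _ _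
  map_smul' _ _ := smul_comp _ _ _ _

/-- The next group in the long exact sequence is a positive `Ext` into an injective object. -/
theorem compExtClass_surjective (T : C) {S : ShortComplex C} (hS : S.ShortExact)
    [Injective S.X₂] (q : ℕ) : Function.Surjective (compExtClass k T hS q) := fun x =>
  covariant_sequence_exact₁ T hS x (eq_zero_of_injective _) rfl

theorem compExtClass_eq_zero_iff (T : C) {S : ShortComplex C} (hS : S.ShortExact) (q : ℕ)
    (x : Ext T S.X₃ q) :
    compExtClass k T hS q x = 0 ↔ ∃ y : Ext T S.X₂ q, y.comp (mk₀ S.g) (add_zero q) = x := by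
  refine ⟨covariant_sequence_exact₃ T hS x rfl, ?_⟩
  rintro ⟨y, rfl⟩
  change (y.comp (mk₀ S.g) (add_zero q)).comp hS.extClass (rfl : q + 1 = q + 1) = 0
  rw [comp_assoc_of_second_deg_zero, ShortComplex.ShortExact.comp_extClass, comp_zero]

/-- A functor to cochain complexes that is exact, acyclic on injective objects, and given by
`Hom(T, -)` in degree `0` computes `Ext(T, -)`. -/
theorem nonempty_homology_linearEquiv [EnoughInjectives C]
    (F : C ⥤ CochainComplex (ModuleCat.{u} k) ℕ) [F.PreservesZeroMorphisms]
    (hF : ∀ S : ShortComplex C, S.ShortExact → (S.map F).ShortExact)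
    (hI : ∀ (I : C) [Injective I] (q : ℕ), IsZero ((F.obj I).homology (q + 1)))
    (T : C) (κ : ∀ N : C, (T ⟶ N) ≃ₗ[k] (F.obj N).homology 0)
    (hκ : ∀ {N N' : C} (f : N ⟶ N') (g : T ⟶ N),
      (HomologicalComplex.homologyMap (F.map f) 0).hom (κ N g) = κ N' (g ≫ f)) (q : ℕ) :
    ∀ N : C, Nonempty ((F.obj N).homology q ≃ₗ[k] Ext T N q) := by
  induction q with
  | zero => exact fun N => ⟨(κ N).symm.trans linearEquiv₀.symm⟩
  | succ q ih =>
    intro N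
    let S : ShortComplex C := ShortComplex.mk (Injective.ι N) (cokernel.π (Injective.ι N)) (by simp)
    have hS : S.ShortExact :=
      { exact := ShortComplex.exact_of_g_is_cokernel _ (cokernelIsCokernel (Injective.ι N)) }
    have : Injective S.X₂ := inferInstanceAs (Injective (Injective.under N))
    have hFS := hF S hS
    let δ : (F.obj S.X₃).homology q →ₗ[k] (F.obj S.X₁).homology (q + 1) := (hFS.δ q (q + 1) rfl).hom
    have hδ : Function.Surjective δ := fun x => by
      refine (ShortComplex.moduleCat_exact_iff _).1 (hFS.homology_exact₁ q (q + 1) rfl) x ?_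
      have h₀ : HomologicalComplex.homologyMap (S.map F).f (q + 1) = 0 := (hI S.X₂ q).eq_of_tgt _ _
      change (HomologicalComplex.homologyMap (S.map F).f (q + 1)).hom x = 0
      rw [h₀]
      rfl
    have hδ' : ∀ x, δ x = 0 ↔
        ∃ y, (HomologicalComplex.homologyMap (F.map S.g) q).hom y = x := fun x => by
      refine ⟨(ShortComplex.moduleCat_exact_iff _).1 (hFS.homology_exact₃ q (q + 1) rfl) x, ?_⟩
      rintro ⟨y, rfl⟩
      exact congrArg (fun f : _ ⟶ (F.obj S.X₁).homology (q + 1) => f.hom y)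
        (hFS.comp_δ q (q + 1) rfl)
    -- In degree `1` the middle term does not vanish in degree `0`: both sides are the cokernel of
    -- `Hom(T, S.X₂) → Hom(T, S.X₃)`, and naturality of `κ` identifies them. In higher degrees both
    -- connecting maps are isomorphisms, so any isomorphism for `S.X₃` will do.
    rcases q with _ | q
    · let α : (T ⟶ S.X₃) →ₗ[k] (F.obj S.X₁).homology 1 := δ ∘ₗ (κ S.X₃).toLinearMap
      let β : (T ⟶ S.X₃) →ₗ[k] Ext T S.X₁ 1 :=
        compExtClass k T hS 0 ∘ₗ (linearEquiv₀ (R := k)).symm.toLinearMap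
      have hα : Function.Surjective α := hδ.comp (κ S.X₃).surjective
      have hβ : Function.Surjective β :=
        (compExtClass_surjective (k := k) T hS 0).comp (linearEquiv₀ (R := k)).symm.surjective
      have hαβ : LinearMap.ker α = LinearMap.ker β := by
        ext g
        have h₁ : α g = 0 ↔ ∃ h : T ⟶ S.X₂, h ≫ S.g = g := by
          refine (hδ' _).trans ⟨?_, ?_⟩
          · rintro ⟨y, hy⟩
            obtain ⟨h, rfl⟩ := (κ S.X₂).surjective y
            exact ⟨h, (κ S.X₃).injective ((hκ S.g h).symm.trans hy)⟩
          · rintro ⟨h, rfl⟩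
            exact ⟨κ S.X₂ h, hκ S.g h⟩
        have h₂ : β g = 0 ↔ ∃ h : T ⟶ S.X₂, h ≫ S.g = g := by
          refine (compExtClass_eq_zero_iff (k := k) T hS 0 _).trans ⟨?_, ?_⟩
          · rintro ⟨y, hy⟩
            obtain ⟨h, rfl⟩ := (linearEquiv₀ (R := k)).symm.surjective y
            refine ⟨h, (linearEquiv₀ (R := k)).symm.injective (Eq.trans ?_ hy)⟩
            exact (mk₀_comp_mk₀ _ _).symm
          · rintro ⟨h, rfl⟩
            exact ⟨mk₀ h, mk₀_comp_mk₀ _ _⟩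
        rw [LinearMap.mem_ker, LinearMap.mem_ker, h₁, h₂]
      exact ⟨(α.quotKerEquivOfSurjective hα).symm.trans
        ((Submodule.quotEquivOfEq _ _ hαβ).trans (β.quotKerEquivOfSurjective hβ))⟩
    · obtain ⟨e⟩ := ih S.X₃
      have hδi : Function.Injective δ := by
        refine (injective_iff_map_eq_zero δ).2 fun x hx => ?_
        obtain ⟨y, rfl⟩ := (hδ' x).1 hx
        have h₀ : HomologicalComplex.homologyMap (F.map S.g) (q + 1) = 0 :=
          (hI S.X₂ q).eq_of_src _ _
        rw [h₀]
        rfl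
      have hεi : Function.Injective (compExtClass k T hS (q + 1)) := by
        refine (injective_iff_map_eq_zero _).2 fun x hx => ?_
        obtain ⟨y, rfl⟩ := (compExtClass_eq_zero_iff (k := k) T hS (q + 1) x).1 hx
        rw [eq_zero_of_injective y, zero_comp]
      exact ⟨(LinearEquiv.ofBijective δ ⟨hδi, hδ⟩).symm.trans (e.trans
        (LinearEquiv.ofBijective _ ⟨hεi, compExtClass_surjective (k := k) T hS (q + 1)⟩))⟩

end CategoryTheory.Abelian.Ext

/-! ### Exactness, acyclicity on injectives, and cohomology in degree zero. -/

namespace TrivSqZeroExt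

open Hochschild AlgBimodule

variable {k : Type v} [Field k] {A M : Type u} [Ring A] [Algebra k A] [AddCommGroup M] [Module k M]
  [Module A M] [Module Aᵐᵒᵖ M] [SMulCommClass A Aᵐᵒᵖ M] [IsScalarTower k A M]
  [IsScalarTower k Aᵐᵒᵖ M]

section Exact

instance (p : ℕ) : (weightFunctor k A M p).PreservesZeroMorphisms where
  map_zero N N' := by
    ext q g
    exact Subtype.ext (MultilinearMap.ext fun w => rfl)

/-- Exactness is checked degreewise, where only the `k`-linear structure matters: composing cochains
with a `k`-linear retraction or section preserves the weight. -/
theorem weightFunctor_shortExact (p : ℕ) (S : ShortComplex (ModuleCat.{u} (A ⊗[k] Aᵐᵒᵖ)))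
    (hS : S.ShortExact) : (S.map (weightFunctor k A M p)).ShortExact := by
  refine (HomologicalComplex.shortExact_iff_degreewise_shortExact _).2 fun q => ?_
  have hf : Function.Injective (homMap S.f) := (ModuleCat.mono_iff_injective S.f).1 hS.mono_f
  have hg : Function.Surjective (homMap S.g) := (ModuleCat.epi_iff_surjective S.g).1 hS.epi_g
  have hfg : ∀ x, homMap S.g x = 0 → ∃ y, homMap S.f y = x :=
    (ShortComplex.moduleCat_exact_iff S).1 hS.exact
  obtain ⟨ρ, hρ⟩ := (homMap S.f).exists_leftInverse_of_injective (LinearMap.ker_eq_bot.2 hf)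
  obtain ⟨σ, hσ⟩ := (homMap S.g).exists_rightInverse_of_surjective (LinearMap.range_eq_top.2 hg)
  refine { exact := ?_, mono_f := ?_, epi_g := ?_ }
  · refine (ShortComplex.moduleCat_exact_iff _).2 fun (x : weight k A M _ p (p + q)) hx => ?_
    refine ⟨weightMap k A M ρ p (p + q) x, Subtype.ext (MultilinearMap.ext fun w => ?_)⟩
    have hw : homMap S.g (x.1 w) = 0 := congrArg
      (fun y : weight k A M (ofModuleCat S.X₃).carrier p (p + q) => y.1 w) hx
    obtain ⟨y, hy⟩ := hfg _ hw
    change homMap S.f (ρ (x.1 w)) = x.1 w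
    rw [← hy]
    exact congrArg (homMap S.f) (LinearMap.congr_fun hρ y)
  · refine (ModuleCat.mono_iff_injective _).2
      fun (x y : weight k A M (ofModuleCat S.X₁).carrier p (p + q)) hxy => ?_
    refine Subtype.ext (MultilinearMap.ext fun w => hf ?_)
    exact congrArg (fun y : weight k A M (ofModuleCat S.X₂).carrier p (p + q) => y.1 w) hxy
  · refine (ModuleCat.epi_iff_surjective _).2
      fun (x : weight k A M (ofModuleCat S.X₃).carrier p (p + q)) => ?_
    refine ⟨weightMap k A M σ p (p + q) x, Subtype.ext (MultilinearMap.ext fun w => ?_)⟩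
    exact LinearMap.congr_fun hσ (x.1 w)

end Exact

section Acyclic

theorem isZero_homology_of_weightAcyclic {X : Type u} [AddCommGroup X] [Module k X] [Module A X]
    [Module Aᵐᵒᵖ X] [SMulCommClass A Aᵐᵒᵖ X] [IsScalarTower k A X] [IsScalarTower k Aᵐᵒᵖ X] {p : ℕ}
    (h : WeightAcyclic k A M X p) (q : ℕ) :
    Limits.IsZero ((weightComplex k A M X p).homology (q + 1)) := by
  rw [← HomologicalComplex.exactAt_iff_isZero_homology,
    HomologicalComplex.exactAt_iff' _ q (q + 1) (q + 1 + 1) (by simp) (by simp)]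
  refine (ShortComplex.moduleCat_exact_iff _).2
    fun (f : weight k A M X p (p + (q + 1))) hf => ?_
  change ((weightComplex k A M X p).d (q + 1) (q + 1 + 1)).hom f = 0 at hf
  change ∃ g, ((weightComplex k A M X p).d q (q + 1)).hom g = f
  rw [weightComplex_d] at hf ⊢
  -- Degree `q + 1` of the complex consists of cochains in `p + q + 1 > p` variables, the range
  -- covered by `WeightAcyclic`.
  obtain ⟨g, hg, hgf⟩ := h (p + q) (Nat.le_add_right p q) f.1 f.2 (congrArg Subtype.val hf)
  exact ⟨⟨g, hg⟩, Subtype.ext hgf⟩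

variable (I : ModuleCat.{u} (A ⊗[k] Aᵐᵒᵖ))

/-- The bimodule map underlying a homomorphism. -/
def ofToModuleCat {P : AlgBimodule k A} {N : ModuleCat.{u} (A ⊗[k] Aᵐᵒᵖ)} (f : P.toModuleCat ⟶ N) :
    P.carrier →ₗ[k] (ofModuleCat N).carrier :=
  homMap f ∘ₗ P.unitEquiv.toLinearMap

theorem ofToModuleCat_smul {P : AlgBimodule k A} {N : ModuleCat.{u} (A ⊗[k] Aᵐᵒᵖ)}
    (f : P.toModuleCat ⟶ N) (a : A) (x : P.carrier) :
    ofToModuleCat f (a • x) = a • ofToModuleCat f x :=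
  (congrArg (homMap f) (unitEquiv_smul P a x)).trans (homMap_smul f a _)

theorem ofToModuleCat_op_smul {P : AlgBimodule k A} {N : ModuleCat.{u} (A ⊗[k] Aᵐᵒᵖ)}
    (f : P.toModuleCat ⟶ N) (a : A) (x : P.carrier) :
    ofToModuleCat f (op a • x) = op a • ofToModuleCat f x :=
  (congrArg (homMap f) (unitEquiv_op_smul P (op a) x)).trans (homMap_op_smul f a _)

/-- An injective bimodule is a retract of every bimodule in which it embeds. -/
theorem weightAcyclic_of_injective_of_mono [Injective I] {p : ℕ} (Q : AlgBimodule k A)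
    (hQ : WeightAcyclic k A M Q.carrier p) (i : (ofModuleCat I).carrier →ₗ[k] Q.carrier)
    (hi : ∀ (a : A) x, i (a • x) = a • i x) (hi' : ∀ (a : A) x, i (op a • x) = op a • i x)
    (hinj : Function.Injective i) : WeightAcyclic k A M (ofModuleCat I).carrier p := by
  let ι : I ⟶ Q.toModuleCat := homMk i.toAddMonoidHom
    (fun a x => (hi a x).trans (toModuleCat_left_smul Q a (i x)).symm)
    (fun a x => (hi' a.unop x).trans (toModuleCat_right_smul Q a (i x)).symm)
  have : Mono ι := (ModuleCat.mono_iff_injective ι).2 hinj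
  let r : Q.toModuleCat ⟶ I := Injective.factorThru (𝟙 I) ι
  have hr : ι ≫ r = 𝟙 I := Injective.comp_factorThru _ _
  exact hQ.of_retract i (ofToModuleCat r) hi hi' (ofToModuleCat_smul r) (ofToModuleCat_op_smul r)
    (fun x => congrArg (fun f : I ⟶ I => f.hom x) hr)

/-- An injective bimodule embeds in a coinduced one by `x ↦ (a ↦ x a)` or `x ↦ (a ↦ a x)`, and
evaluation at `1` shows injectivity. The side of projectivity decides which coinduction is known to
be acyclic. -/
theorem weightAcyclic_of_injective (hM : Module.Projective A M ∨ Module.Projective Aᵐᵒᵖ M)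
    [Injective I] (p : ℕ) : WeightAcyclic k A M (ofModuleCat I).carrier p := by
  rcases hM with hM | hM
  · refine weightAcyclic_of_injective_of_mono I ⟨RightCoind k A (ofModuleCat I).carrier⟩
      (weightAcyclic_rightCoind_of_projective p _)
      { toFun := fun x =>
          (LinearMap.toSpanSingleton Aᵐᵒᵖ (ofModuleCat I).carrier x).restrictScalars k ∘ₗ
            (opLinearEquiv k).toLinearMap
        map_add' := fun x y => RightCoind.ext fun a => smul_add (op a) x y
        map_smul' := fun c x => RightCoind.ext fun a => smul_comm (op a) c x }
      (fun a x => RightCoind.ext fun b => ?_) (fun a x => RightCoind.ext fun b => ?_)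
      (fun x y h => ?_)
    · exact (smul_comm a (op b) x).symm
    · exact (mul_smul (op b) (op a) x).symm
    · have h₁ := congrArg (fun g : RightCoind k A (ofModuleCat I).carrier => g (1 : A)) h
      exact (one_smul Aᵐᵒᵖ x).symm.trans (h₁.trans (one_smul Aᵐᵒᵖ y))
  · refine weightAcyclic_of_injective_of_mono I ⟨LeftCoind k A (ofModuleCat I).carrier⟩
      (weightAcyclic_leftCoind_of_projective p _)
      { toFun := fun x =>
          (LinearMap.toSpanSingleton A (ofModuleCat I).carrier x).restrictScalars k
        map_add' := fun x y => LeftCoind.ext fun a => smul_add a x y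
        map_smul' := fun c x => LeftCoind.ext fun a => smul_comm a c x }
      (fun a x => LeftCoind.ext fun b => ?_) (fun a x => LeftCoind.ext fun b => ?_)
      (fun x y h => ?_)
    · exact (mul_smul b a x).symm
    · exact smul_comm b (op a) x
    · have h₁ := congrArg (fun g : LeftCoind k A (ofModuleCat I).carrier => g (1 : A)) h
      exact (one_smul A x).symm.trans (h₁.trans (one_smul A y))

end Acyclic

section DegreeZero

variable (p : ℕ) (N : ModuleCat.{u} (A ⊗[k] Aᵐᵒᵖ))

/-- Composition of a homomorphism with the universal cocycle. -/
def homToWeight : ((tensorPower (⟨M⟩ : AlgBimodule k A) p).toModuleCat ⟶ N) →ₗ[k]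
    weight k A M (ofModuleCat N).carrier p p where
  toFun f := weightMap k A M (ofToModuleCat f) p p
    ⟨tensorCocycle k A M p, tensorCocycle_mem_weight k A M p⟩
  map_add' _ _ := rfl
  map_smul' _ _ := rfl

theorem homToWeight_injective : Function.Injective (homToWeight (M := M) p N) := by
  intro f g h
  have key : ofToModuleCat f = ofToModuleCat g :=
    tensorPower_hom_ext p (ofToModuleCat_smul f) (ofToModuleCat_smul g)
      (fun w => congrArg (fun y => y.1 w) h) (ofToModuleCat_op_smul f) (ofToModuleCat_op_smul g)
      inferInstance
  exact ModuleCat.hom_ext (LinearMap.ext fun t => LinearMap.congr_fun key t)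

theorem d_homToWeight (f : (tensorPower (⟨M⟩ : AlgBimodule k A) p).toModuleCat ⟶ N) :
    weightD k A M _ p p (homToWeight p N f) = 0 := by
  have h := map_d (ofToModuleCat f) (fun b => ofToModuleCat_smul f b.fst)
    (fun b => ofToModuleCat_op_smul f b.fst) (tensorCocycle k A M p)
  rw [d_tensorCocycle] at h
  exact Subtype.ext (h.symm.trans (MultilinearMap.ext fun w => map_zero (ofToModuleCat f)))

theorem exists_homToWeight_eq (g : weight k A M (ofModuleCat N).carrier p p)
    (hg : weightD k A M _ p p g = 0) : ∃ f, homToWeight p N f = g := by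
  obtain ⟨φ, hφ, hφ', hφg⟩ := exists_tensorPower_hom p g.1 g.2 (congrArg Subtype.val hg)
  refine ⟨homMk φ.toAddMonoidHom (fun a x => ?_) (fun a x => ?_), Subtype.ext hφg⟩
  · exact (congrArg φ (toModuleCat_left_smul _ a x)).trans (hφ a x)
  · exact (congrArg φ (toModuleCat_right_smul _ a x)).trans (hφ' a.unop x)

/-- Homomorphisms as cycles of degree `0`. -/
def homToCycles : ModuleCat.of k ((tensorPower (⟨M⟩ : AlgBimodule k A) p).toModuleCat ⟶ N) ⟶
    ((weightFunctor k A M p).obj N).cycles 0 :=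
  HomologicalComplex.liftCycles _ (ModuleCat.ofHom (homToWeight p N)) 1 (by simp) (by
    refine (congrArg (ModuleCat.ofHom (homToWeight p N) ≫ ·) (weightComplex_d k A M _ p 0)).trans ?_
    ext f
    exact d_homToWeight p N f)

theorem homToCycles_i : homToCycles (M := M) p N ≫ HomologicalComplex.iCycles _ 0 =
    ModuleCat.ofHom (homToWeight p N) := HomologicalComplex.liftCycles_i _ _ _ _ _

theorem homToCycles_bijective : Function.Bijective (homToCycles (M := M) p N).hom := by
  have hi : ∀ f, (HomologicalComplex.iCycles ((weightFunctor k A M p).obj N) 0).hom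
      ((homToCycles p N).hom f) = homToWeight p N f := fun f =>
    congrArg (fun φ => φ.hom f) (homToCycles_i (M := M) p N)
  constructor
  · intro f g h
    refine homToWeight_injective p N ?_
    rw [← hi, ← hi, h]
  · intro z
    obtain ⟨f, hf⟩ := exists_homToWeight_eq p N
      ((HomologicalComplex.iCycles ((weightFunctor k A M p).obj N) 0).hom z) (by
        have h := HomologicalComplex.iCycles_d ((weightFunctor k A M p).obj N) 0 1
        -- Degree `0` consists of cochains in `p + 0` variables, which is `p` by definition.
        have h' : ((weightFunctor k A M p).obj N).d 0 1 = ModuleCat.ofHom (weightD k A M _ p p) :=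
          weightComplex_d k A M _ p 0
        rw [h'] at h
        exact congrArg (fun φ => φ.hom z) h)
    refine ⟨f, (ModuleCat.mono_iff_injective
      (HomologicalComplex.iCycles ((weightFunctor k A M p).obj N) 0)).1 inferInstance ?_⟩
    exact (hi f).trans hf

/-- Cohomology in degree `0`. -/
def homEquivHomology : ((tensorPower (⟨M⟩ : AlgBimodule k A) p).toModuleCat ⟶ N) ≃ₗ[k]
    ((weightFunctor k A M p).obj N).homology 0 :=
  (LinearEquiv.ofBijective (homToCycles p N).hom (homToCycles_bijective p N)).trans
    (CochainComplex.isoHomologyπ₀ ((weightFunctor k A M p).obj N)).toLinearEquiv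

theorem homologyMap_homEquivHomology {N' : ModuleCat.{u} (A ⊗[k] Aᵐᵒᵖ)} (f : N ⟶ N')
    (g : (tensorPower (⟨M⟩ : AlgBimodule k A) p).toModuleCat ⟶ N) :
    (HomologicalComplex.homologyMap ((weightFunctor k A M p).map f) 0).hom
      (homEquivHomology p N g) = homEquivHomology p N' (g ≫ f) := by
  have h₁ : (HomologicalComplex.cyclesMap ((weightFunctor k A M p).map f) 0).hom
      ((homToCycles p N).hom g) = (homToCycles p N').hom (g ≫ f) := by
    refine (ModuleCat.mono_iff_injective
      (HomologicalComplex.iCycles ((weightFunctor k A M p).obj N') 0)).1 inferInstance ?_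
    have h₂ := congrArg (fun φ => φ.hom ((homToCycles p N).hom g))
      (HomologicalComplex.cyclesMap_i ((weightFunctor k A M p).map f) 0)
    have h₃ := congrArg (fun φ => φ.hom g) (homToCycles_i (M := M) p N)
    have h₄ := congrArg (fun φ => φ.hom (g ≫ f)) (homToCycles_i (M := M) p N')
    refine h₂.trans (Eq.trans ?_ h₄.symm)
    exact congrArg (((weightFunctor k A M p).map f).f 0).hom h₃
  have h₅ := congrArg (fun φ => φ.hom ((homToCycles p N).hom g))
    (HomologicalComplex.homologyπ_naturality ((weightFunctor k A M p).map f) 0)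
  exact h₅.trans (congrArg (HomologicalComplex.homologyπ ((weightFunctor k A M p).obj N') 0).hom h₁)

end DegreeZero

theorem nonempty_homology_weightComplex_equiv_ext
    (hM : Module.Projective A M ∨ Module.Projective Aᵐᵒᵖ M) (p q : ℕ)
    (N : ModuleCat.{u} (A ⊗[k] Aᵐᵒᵖ)) :
    Nonempty ((weightComplex k A M (ofModuleCat N).carrier p).homology q ≃ₗ[k]
      Abelian.Ext ((tensorPower (⟨M⟩ : AlgBimodule k A) p).toModuleCat) N q) :=
  Abelian.Ext.nonempty_homology_linearEquiv (weightFunctor k A M p) (weightFunctor_shortExact p)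
    (fun I _ q => isZero_homology_of_weightAcyclic (weightAcyclic_of_injective I hM p) q) _
    (homEquivHomology p) (fun f g => homologyMap_homEquivHomology p _ f g) q N

end TrivSqZeroExt

/-! ### The columns as weight complexes of the trivial extension. -/

namespace SplitAlgebra

open Finset Hochschild

variable {k : Type v} [Field k] {A M : Type u} [Ring A] [Algebra k A] [NonUnitalRing M]
  [Module k M] [Module A M] [Module Aᵐᵒᵖ M] [SMulCommClass A Aᵐᵒᵖ M] [IsScalarTower k A M]
  [IsScalarTower k Aᵐᵒᵖ M] [MultiplicativeBimodule A M]
variable {X : Type u} [AddCommGroup X] [Module k X] [Module (SplitAlgebra A M) X]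
  [Module (SplitAlgebra A M)ᵐᵒᵖ X] [SMulCommClass (SplitAlgebra A M) (SplitAlgebra A M)ᵐᵒᵖ X]
  [IsScalarTower k (SplitAlgebra A M) X] [IsScalarTower k (SplitAlgebra A M)ᵐᵒᵖ X]
variable {Y : Type u} [AddCommGroup Y] [Module k Y] [Module A Y] [Module Aᵐᵒᵖ Y]
  [SMulCommClass A Aᵐᵒᵖ Y] [IsScalarTower k A Y] [IsScalarTower k Aᵐᵒᵖ Y]

variable (k A M) in
/-- The trivial extension and the split algebra have the same underlying space. -/
def ofTrivSqZeroExt : TrivSqZeroExt A M ≃ₗ[k] SplitAlgebra A M where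
  toFun x := x
  invFun x := x
  map_add' _ _ := rfl
  map_smul' _ _ := rfl
  left_inv _ := rfl
  right_inv _ := rfl

@[simp] theorem fst_ofTrivSqZeroExt (x : TrivSqZeroExt A M) :
    (ofTrivSqZeroExt k A M x).1 = x.fst := rfl

@[simp] theorem snd_ofTrivSqZeroExt (x : TrivSqZeroExt A M) :
    (ofTrivSqZeroExt k A M x).2 = x.snd := rfl

/-- The cochains in `Hom_k(M^{p,q}, X)` only depend on the space underlying the split algebra. -/
def spotEquiv (e : X ≃ₗ[k] Y) (p n : ℕ) :
    spot k A M X p n ≃ₗ[k] TrivSqZeroExt.weight k A M Y p n where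
  toFun f := ⟨e.toLinearMap.compMultilinearMap
      (f.1.compLinearMap fun _ => (ofTrivSqZeroExt k A M).toLinearMap),
    fun S x hS hx => (congrArg e (f.2 S (fun i => ofTrivSqZeroExt k A M (x i)) hS hx)).trans
      (map_zero e)⟩
  invFun f := ⟨e.symm.toLinearMap.compMultilinearMap
      (f.1.compLinearMap fun _ => (ofTrivSqZeroExt k A M).symm.toLinearMap),
    fun S x hS hx => (congrArg e.symm
      (f.2 S (fun i => (ofTrivSqZeroExt k A M).symm (x i)) hS hx)).trans (map_zero e.symm)⟩
  map_add' f g := by ext; simp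
  map_smul' c f := by ext; simp
  left_inv f := by ext; simp
  right_inv f := by ext; simp

theorem spotEquiv_apply (e : X ≃ₗ[k] Y) (p n : ℕ) (f : spot k A M X p n)
    (x : Fin n → TrivSqZeroExt A M) :
    (spotEquiv e p n f).1 x = e (f.1 fun i => ofTrivSqZeroExt k A M (x i)) := rfl

theorem card_image_predAbove_lt {n : ℕ} {S : Finset (Fin (n + 1))} {j : Fin n}
    (h : j.castSucc ∈ S) (h' : j.succ ∈ S) : (S.image (Fin.predAbove j)).card < S.card := by
  refine lt_of_le_of_ne card_image_le fun hc => ?_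
  have := card_image_iff.1 hc (mem_coe.2 h) (mem_coe.2 h') (by simp)
  exact absurd this (Fin.castSucc_lt_succ).ne

theorem contractNth_snd_eq_zero {n : ℕ} {S : Finset (Fin (n + 1))}
    {x : Fin (n + 1) → SplitAlgebra A M} (hx : ∀ i ∉ S, (x i).2 = 0) (j : Fin n) (i : Fin n)
    (hi : i ∉ S.image (Fin.predAbove j)) :
    (Fin.contractNth j.castSucc (· * ·) x i).2 = 0 := by
  have hi' : ∀ s, Fin.predAbove j s = i → (x s).2 = 0 := fun s hs => hx s fun hsS =>
    hi (mem_image.2 ⟨s, hsS, hs⟩)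
  rcases lt_trichotomy (i : ℕ) j with h | h | h
  · rw [Fin.contractNth_apply_of_lt _ _ _ _ h]
    refine hi' _ (Fin.ext ?_)
    rw [TrivSqZeroExt.val_predAbove, if_neg (by simp only [Fin.val_castSucc]; omega),
      Fin.val_castSucc]
  · obtain rfl : i = j := Fin.ext h
    rw [Fin.contractNth_apply_of_eq _ _ _ _ (by simp), snd_mul, hi' i.castSucc (by simp),
      hi' i.succ (by simp)]
    simp
  · rw [Fin.contractNth_apply_of_gt _ _ _ _ h]
    refine hi' _ (Fin.ext ?_)
    rw [TrivSqZeroExt.val_predAbove, if_pos (by simp only [Fin.val_succ]; omega), Fin.val_succ,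
      Nat.add_sub_cancel]

/-- The two coboundaries are compared term by term on a word with `p` entries in `M`. Terms that use
only the `A`-bimodule structures agree; the others vanish for the split algebra because `f` vanishes
below `p` entries in `M`, and for the trivial extension because `M` multiplies and acts by zero. -/
theorem spotEquiv_d (e : X ≃ₗ[k] Y) (he : ∀ (a : A) x, e (inl k A M a • x) = a • e x)
    (he' : ∀ (a : A) x, e (op (inl k A M a) • x) = op a • e x) (p n : ℕ)
    (f : spot k A M X p n) {S : Finset (Fin (n + 1))} {x : Fin (n + 1) → TrivSqZeroExt A M}
    (hx : TrivSqZeroExt.HasType S x) (hS : S.card = p) :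
    e (d n f.1 fun i => ofTrivSqZeroExt k A M (x i)) = d n (spotEquiv e p n f).1 x := by
  have hfV : VanishesBelow p n f.1 :=
    vanishesBelow_of_hasType fun S x hS hx => f.2 S x hS.ne hx
  have hx' : HasType S fun i => ofTrivSqZeroExt k A M (x i) := hx
  rw [d_apply, d_apply, map_add, map_add, map_sum]
  simp only [map_smul, spotEquiv_apply, TrivSqZeroExt.smul_eq_fst_smul,
    TrivSqZeroExt.op_smul_eq_fst_smul]
  congr 1
  · congr 1
    -- If the first entry is in `M`, the tail has `p - 1` entries in `M` and `f` kills it.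
    · by_cases h : (0 : Fin (n + 1)) ∈ S
      · rw [hx.1 _ h, zero_smul]
        refine (congrArg e ?_).trans (map_zero e)
        refine (congrArg _ (hfV (univ.filter fun i => i.succ ∈ S) _ ?_ fun i hi => ?_)).trans
          (smul_zero _)
        · rw [TrivSqZeroExt.card_filter_succ_mem, if_pos h] at hS
          omega
        · exact hx.2 i.succ (by simpa using hi)
      · have h₀ : ofTrivSqZeroExt k A M (x 0) = inl k A M (x 0).fst :=
          SplitAlgebra.ext rfl (hx.2 _ h)
        rw [h₀, he]
        rfl
    · refine sum_congr rfl fun j _ => ?_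
      congr 2
      -- Two neighbours in `M` merge into one entry of the split algebra, so the contracted word has
      -- its `M`-parts at fewer than `p` places. Otherwise one of the two `M`-parts is zero and both
      -- algebras give the same product.
      by_cases h : j.castSucc ∈ S ∧ j.succ ∈ S
      · rw [hfV (S.image (Fin.predAbove j)) _ ((card_image_predAbove_lt h.1 h.2).trans_eq hS)
          (contractNth_snd_eq_zero hx'.2 j)]
        refine (f.1.map_coord_zero j ?_).symm
        rw [Fin.contractNth_apply_of_eq _ _ _ _ (by simp)]
        refine SplitAlgebra.ext ?_ ?_
        · simp [hx.1 _ h.1]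
        · simp [hx.1 _ h.1, hx.1 _ h.2]
      · congr 1
        funext i
        rcases lt_trichotomy (i : ℕ) j with hij | hij | hij
        · rw [Fin.contractNth_apply_of_lt _ _ _ _ hij, Fin.contractNth_apply_of_lt _ _ _ _ hij]
        · rw [Fin.contractNth_apply_of_eq _ _ _ _ hij, Fin.contractNth_apply_of_eq _ _ _ _ hij]
          obtain rfl : i = j := Fin.ext hij
          have hz : (x i.castSucc).snd * (x i.succ).snd = 0 := by
            by_cases h₁ : i.castSucc ∈ S
            · rw [hx.2 i.succ fun h₂ => h ⟨h₁, h₂⟩, mul_zero]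
            · rw [hx.2 _ h₁, zero_mul]
          refine SplitAlgebra.ext ?_ ?_
          · simp
          · simp [hz]
        · rw [Fin.contractNth_apply_of_gt _ _ _ _ hij, Fin.contractNth_apply_of_gt _ _ _ _ hij]
  · congr 1
    by_cases h : Fin.last (n) ∈ S
    · rw [hx.1 _ h, op_zero, zero_smul]
      refine (congrArg e ?_).trans (map_zero e)
      refine (congrArg _ (hfV (univ.filter fun i => i.castSucc ∈ S) _ ?_ fun i hi => ?_)).trans
        (smul_zero _)
      · rw [TrivSqZeroExt.card_filter_castSucc_mem, if_pos h] at hS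
        omega
      · exact hx.2 i.castSucc (by simpa using hi)
    · have h₀ : ofTrivSqZeroExt k A M (x (Fin.last n)) = inl k A M (x (Fin.last n)).fst :=
        SplitAlgebra.ext rfl (hx.2 _ h)
      rw [h₀, he']
      rfl

/-- Both sides have weight `p`, so it suffices to test words with `p` entries in `M`, where taking
the component does not change the coboundary. -/
theorem spotEquiv_dv (e : X ≃ₗ[k] Y) (he : ∀ (a : A) x, e (inl k A M a • x) = a • e x)
    (he' : ∀ (a : A) x, e (op (inl k A M a) • x) = op a • e x) (p q : ℕ)
    (f : spot k A M X p (p + q)) :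
    spotEquiv e p (p + (q + 1)) (dv k A M X p q f) =
      TrivSqZeroExt.weightD k A M Y p (p + q) (spotEquiv e p (p + q) f) := by
  refine Subtype.ext (sub_eq_zero.1 (TrivSqZeroExt.eq_zero_of_hasType k fun S x hx => ?_))
  rw [sub_apply, sub_eq_zero]
  by_cases hS : S.card = p
  · have hx' : HasType S fun i => ofTrivSqZeroExt k A M (x i) := hx
    have hc : (dv k A M X p q f).1 (fun i => ofTrivSqZeroExt k A M (x i)) =
        d (p + q) f.1 fun i => ofTrivSqZeroExt k A M (x i) := component_of_card_eq _ hx' hS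
    rw [spotEquiv_apply, hc]
    exact spotEquiv_d e he he' p (p + q) f hx hS
  · rw [(spotEquiv e p (p + (q + 1)) (dv k A M X p q f)).2 S x hS hx]
    exact ((TrivSqZeroExt.weightD k A M Y p (p + q) (spotEquiv e p (p + q) f)).2 S x hS hx).symm

/-- The columns of the double complex as weight parts of the Hochschild complex of a trivial
extension. -/
def columnIso (e : X ≃ₗ[k] Y) (he : ∀ (a : A) x, e (inl k A M a • x) = a • e x)
    (he' : ∀ (a : A) x, e (op (inl k A M a) • x) = op a • e x) (p : ℕ) :
    column k A M X p ≅ TrivSqZeroExt.weightComplex k A M Y p :=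
  HomologicalComplex.Hom.isoOfComponents
    (fun q => (spotEquiv (A := A) (M := M) e p (p + q)).toModuleIso) (by
      rintro q _ rfl
      have h : (column k A M X p).d q (q + 1) = ModuleCat.ofHom (dv k A M X p q) :=
        CochainComplex.of_d (fun q => ModuleCat.of k (spot k A M X p (p + q)))
          (fun q => ModuleCat.ofHom (dv k A M X p q)) q
      rw [h, TrivSqZeroExt.weightComplex_d]
      ext f
      exact (spotEquiv_dv e he he' p q f).symm)

end SplitAlgebra

end

/-! ### The theorem. -/

theorem theorem2p4 {k : Type v} [Field k] {A M X : Type u} [Ring A] [Algebra k A]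
    [NonUnitalRing M] [Module k M] [Module A M] [Module Aᵐᵒᵖ M] [SMulCommClass A Aᵐᵒᵖ M]
    [IsScalarTower k A M] [IsScalarTower k Aᵐᵒᵖ M] [MultiplicativeBimodule A M]
    [AddCommGroup X] [Module k X]
    [Module (SplitAlgebra A M) X] [Module (SplitAlgebra A M)ᵐᵒᵖ X]
    [SMulCommClass (SplitAlgebra A M) (SplitAlgebra A M)ᵐᵒᵖ X]
    [IsScalarTower k (SplitAlgebra A M) X] [IsScalarTower k (SplitAlgebra A M)ᵐᵒᵖ X]
    (hM : Module.Projective A M ∨ Module.Projective Aᵐᵒᵖ M) (p q : ℕ) :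
    Nonempty ((SplitAlgebra.column k A M X p).homology q ≃ₗ[k]
      Abelian.Ext
        ((AlgBimodule.tensorPower (⟨M⟩ : AlgBimodule k A) p).toModuleCat)
        ((AlgBimodule.restrictScalars (SplitAlgebra.inl k A M)
          (⟨X⟩ : AlgBimodule k (SplitAlgebra A M))).toModuleCat) q) := by
  let R := AlgBimodule.restrictScalars (SplitAlgebra.inl k A M)
    (⟨X⟩ : AlgBimodule k (SplitAlgebra A M))
  -- The underlying map is the identity of `X`; it matches the action of `A ⊆ Λ` with the action
  -- through the enveloping algebra.
  let e : X ≃ₗ[k] (AlgBimodule.ofModuleCat R.toModuleCat).carrier := R.unitEquiv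
  let i := SplitAlgebra.columnIso (A := A) (M := M) e
    (fun a x => AlgBimodule.unitEquiv_smul R a x)
    (fun a x => AlgBimodule.unitEquiv_op_smul R (op a) x) p
  obtain ⟨j⟩ := TrivSqZeroExt.nonempty_homology_weightComplex_equiv_ext (k := k) (M := M) hM p q
    R.toModuleCat
  exact ⟨((HomologicalComplex.homologyMapIso i q).toLinearEquiv).trans j⟩
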